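/- Let $L\ge 2$ and place one qubit on each of the $N=2L^2$ edges of the $L\times L$ square lattice with periodic boundary conditions, so that $\mathcal H\cong\mathbb C^{2^N}$. Let $$H=-\sum_s \mathbf X_s-\sum_p \mathbf Z_p,\qquad \mathbf X_s=\prod_{i\in s}\sigma_i^x,\quad \mathbf Z_p=\prod_{i\in p}\sigma_i^z$$ be the toric code Hamiltonian, where $s$ runs over the stars (the four edges at a node) and $p$ over the plaquettes (the four edges of a cell). For $\beta>0$ and a Pauli operator $S$ let $$\mathcal L_S(A)=\sum_\omega \frac{2}{e^{\beta\omega}+1}\Big(S(\omega)^\dagger A\,S(\omega)-\tfrac12\{S(\omega)^\dagger S(\omega),A\}\Big),\qquad S(\omega)=\sum_{\lambda-\mu=\omega}P_\lambda S P_\mu ,$$ be the Davies generator (Heisenberg picture, Glauber rates), where $P_\lambda$ are the eigenprojections of $H$ and $\omega$ runs over the differences of its eigenvalues. The snake consists of the $L^2-1$ edges crossed by the path through the centers of all cells that traverses row $0$ from left to right starting in its column $0$, steps down, traverses row $1$ from right to left, steps down, and so on. The comb consists of $L^2-1$ of the remaining edges and is a spanning tree of the nodes: a vertical spine along column $0$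 and, in each row, a horizontal path of $L-1$ edges starting at the spine; together, snake and comb contain all but two edges. Put $$\mathcal L_{\rm local}=\sum_{j\in{\rm snake}}\mathcal L_{\sigma^x_j}+\sum_{j\in{\rm comb}}\mathcal L_{\sigma^z_j}.$$ Let the logical algebra be generated by logical operators $\mathsf X_1,\mathsf Z_1,\mathsf X_2,\mathsf Z_2$ of the toric code, where $\mathsf X_i$ is a product of $\sigma^x$ along a non-contractible closed path of cells that avoids the comb and $\mathsf Z_i$ is a product of $\sigma^z$ along a straight non-contractible loop of edges that avoids the snake. Let the syndrome algebra be generated by all $\mathbf Z_p$, all $\mathbf X_s$, all $\sigma^x_j$ with $j$ on the snake and all $\sigma^z_j$ with $j$ on the comb. Then there are constants $c,C>0$ such that for every $L\ge2$ there is a unitary identification, independent of $\beta$, $\mathcal H\cong\mathcal H_{\rm logic}\otimes\mathcal H_{\rm syndrome}$ with $\mathcal H_{\rm logic}\cong\mathbb C^4$ and $\mathcal H_{\rm syndrome}\cong\mathbb C^{2^{N-2}}$, under which the logical algebra is $\mathcal B(\mathcal H_{\rm logic})\otimes 1$ and the syndrome algebra is $1\otimes\mathcal B(\mathcal H_{\rm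 syndrome})$, and such that for every $\beta>0$ there is a linear map $\mathcal L_{\rm syn}$ on $\mathcal B(\mathcal H_{\rm syndrome})$ with $$\mathcal L_{\rm local}(A\otimes B)=A\otimes\mathcal L_{\rm syn}(B)\quad\text{for all }A,B,$$ $\ker\mathcal L_{\rm syn}=\mathbb C\,1$, and the spectral gap (the smallest non-zero eigenvalue) of $-\mathcal L_{\rm syn}$ satisfies $$\mathrm{Gap}(-\mathcal L_{\rm syn})\ \ge\ \max\big\{c\,e^{-C\beta},\ c\,N^{-2}\big\}.$$ -/

import Mathlib

open scoped Kronecker Matrix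

noncomputable section

namespace ToricCode

/-! ### Davies generators of a finite-dimensional Hamiltonian -/

section Davies

variable {n : Type} [Fintype n] [DecidableEq n]

/-- The (finite) real spectrum of a matrix. -/
def spec (H : Matrix n n ℂ) : Finset ℝ :=
  (Matrix.finite_real_spectrum (A := H)).toFinset

/-- The matrix of the orthogonal projection onto the eigenspace of `H` for the eigenvalue `a`. -/
def eigenProj (H : Matrix n n ℂ) (a : ℝ) : Matrix n n ℂ :=
  Matrix.toEuclideanLin.symm
    ((Module.End.eigenspace (Matrix.toEuclideanLin H) (a : ℂ)).starProjection :
      EuclideanSpace ℂ n →ₗ[ℂ] EuclideanSpace ℂ n)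

/-- The Bohr frequencies of `H`: all differences of two eigenvalues. -/
def bohr (H : Matrix n n ℂ) : Finset ℝ :=
  Finset.image₂ (fun a b => a - b) (spec H) (spec H)

/-- The Fourier component `S(ω)` of the Heisenberg evolution of `S`: the sum of `P_a S P_b`
over the pairs of eigenvalues with `a - b = ω`. -/
def jump (H S : Matrix n n ℂ) (ω : ℝ) : Matrix n n ℂ :=
  ∑ a ∈ spec H, ∑ b ∈ spec H,
    if a - b = ω then eigenProj H a * S * eigenProj H b else 0

/-- The Glauber transition rate `γ(ω) = 2 / (exp (β ω) + 1)`. -/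
def glauber (β ω : ℝ) : ℝ := 2 / (Real.exp (β * ω) + 1)

/-- The dissipator of a jump operator `K`, in the Heisenberg picture. -/
def dissipator (K : Matrix n n ℂ) : Matrix n n ℂ →ₗ[ℂ] Matrix n n ℂ where
  toFun A := Kᴴ * A * K - (1 / 2 : ℂ) • (Kᴴ * K * A + A * (Kᴴ * K))
  map_add' A B := by
    simp only [mul_add, add_mul, smul_add]
    abel
  map_smul' z A := by
    simp only [mul_smul_comm, smul_mul_assoc, RingHom.id_apply, smul_sub, smul_add,
      smul_comm z (1 / 2 : ℂ)]

/-- The Davies generator (Heisenberg picture, Glauber rates) of the Hamiltonian `H` at inverse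
temperature `β` with a single coupling operator `S`. -/
def davies (β : ℝ) (H S : Matrix n n ℂ) : Matrix n n ℂ →ₗ[ℂ] Matrix n n ℂ :=
  ∑ ω ∈ bohr H, (glauber β ω : ℂ) • dissipator (jump H S ω)

end Davies

/-- The spectral gap of an operator: the infimum of (the real parts of) its non-zero
eigenvalues. The operators of interest are diagonalizable with non-negative real spectrum, so
that this is the smallest non-zero eigenvalue. -/
def spectralGap {V : Type} [AddCommGroup V] [Module ℂ V] (T : V →ₗ[ℂ] V) : ℝ :=
  sInf {x : ℝ | ∃ z : ℂ, Module.End.HasEigenvalue T z ∧ z ≠ 0 ∧ x = z.re}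

/-! ### The 2D toric code -/

section Toric

variable (L : ℕ)

/-- The spins: the edges of the `L × L` square lattice with periodic boundary conditions.
`Sum.inl (r, c)` is the horizontal edge from the node `(r, c)` to the node `(r, c + 1)`, and
`Sum.inr (r, c)` is the vertical edge from `(r, c)` to `(r + 1, c)`; rows are numbered downwards
and columns to the right. There are `2 * L ^ 2` of them. -/
abbrev Spin : Type := (Fin L × Fin L) ⊕ (Fin L × Fin L)

/-- Labels of the computational basis of the Hilbert space of all spins. -/
abbrev Conf : Type := Spin L → ZMod 2

/-- Operators on the Hilbert space of all spins. -/
abbrev Op : Type := Matrix (Conf L) (Conf L) ℂ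

variable {L}

/-- The horizontal edge from the node `(r, c)` to the node `(r, c + 1)`. -/
abbrev hor (r c : Fin L) : Spin L := Sum.inl (r, c)

/-- The vertical edge from the node `(r, c)` to the node `(r + 1, c)`. -/
abbrev ver (r c : Fin L) : Spin L := Sum.inr (r, c)

/-- The Pauli matrix `σ^x` of the spin `j`: it flips the `j`-th bit. -/
def sigmaX (j : Spin L) : Op L :=
  Matrix.of fun s t => if s = t + Pi.single j 1 then 1 else 0

/-- The Pauli matrix `σ^z` of the spin `j`. -/
def sigmaZ (j : Spin L) : Op L :=
  Matrix.diagonal fun s => if s j = 0 then 1 else -1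

lemma sigmaX_mul (i j : Spin L) :
    sigmaX i * sigmaX j =
      Matrix.of fun s t => if s = t + Pi.single i 1 + Pi.single j 1 then 1 else 0 := by
  ext s t
  rw [Matrix.mul_apply, Finset.sum_eq_single (t + Pi.single j 1)]
  · simp [sigmaX, add_right_comm]
  · intro b _ hb
    simp [sigmaX, hb]
  · simp

lemma sigmaX_commute (i j : Spin L) : Commute (sigmaX i) (sigmaX j) := by
  rw [commute_iff_eq, sigmaX_mul, sigmaX_mul]
  simp only [add_right_comm]

lemma sigmaZ_commute (i j : Spin L) : Commute (sigmaZ i) (sigmaZ j) := by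
  rw [commute_iff_eq, sigmaZ, sigmaZ, Matrix.diagonal_mul_diagonal,
    Matrix.diagonal_mul_diagonal]
  simp only [mul_comm]

/-- The product of the `σ^x` over a set of spins. -/
def prodX (A : Finset (Spin L)) : Op L :=
  A.noncommProd sigmaX fun i _ j _ _ => sigmaX_commute i j

/-- The product of the `σ^z` over a set of spins. -/
def prodZ (A : Finset (Spin L)) : Op L :=
  A.noncommProd sigmaZ fun i _ j _ _ => sigmaZ_commute i j

variable [NeZero L]

/-- The four edges that meet in the node `v`. -/
def nodeStar (v : Fin L × Fin L) : Finset (Spin L) :=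
  {hor v.1 v.2, hor v.1 (v.2 - 1), ver v.1 v.2, ver (v.1 - 1) v.2}

/-- The four edges of the cell `p`, whose upper left corner is the node `p`. -/
def plaquette (p : Fin L × Fin L) : Finset (Spin L) :=
  {hor p.1 p.2, hor (p.1 + 1) p.2, ver p.1 p.2, ver p.1 (p.2 + 1)}

variable (L) in
/-- The toric code Hamiltonian. -/
def hamiltonian : Op L :=
  -(∑ v : Fin L × Fin L, prodX (nodeStar v)) - ∑ p : Fin L × Fin L, prodZ (plaquette p)

/-- The column of the horizontal edge of row `r` that does not belong to the comb: it is the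
last column for `r = 0` and for odd `r`, and column `0` for even `r ≠ 0`. -/
def turn (r : Fin L) : Fin L :=
  if r.val = 0 ∨ r.val % 2 = 1 then Fin.ofNat L (L - 1) else 0

variable (L) in
/-- The snake: the `L ^ 2 - 1` edges crossed by the path through the centers of all cells that
starts in the cell `(0, 0)`, runs through row `0` to the right, steps down, runs through row `1`
to the left, steps down, and so on, never crossing the vertical edges of column `0` or the
horizontal edges of row `0`. -/
def snake : Finset (Spin L) :=
  Finset.disjSum (Finset.univ.filter fun e => e.1 ≠ 0 ∧ e.2 = turn e.1)
    (Finset.univ.filter fun e => e.2 ≠ 0)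

variable (L) in
/-- The comb: a spanning tree of the nodes, with `L ^ 2 - 1` edges. Its spine consists of the
vertical edges of column `0` without the last one; its teeth are the `L` paths of horizontal
edges that start at the nodes of the spine, one in every row, each visiting all nodes of its
row. -/
def comb : Finset (Spin L) :=
  Finset.disjSum (Finset.univ.filter fun e => e.2 ≠ turn e.1)
    (Finset.univ.filter fun e => e.2 = 0 ∧ e.1.val ≠ L - 1)

variable (L) in
/-- The first logical `Z`: the vertical loop of edges in column `0`. -/
def logicalZ₁ : Op L := prodZ (Finset.univ.image fun r : Fin L => ver r 0)

variable (L) in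
/-- The second logical `Z`: the horizontal loop of edges in row `0`. -/
def logicalZ₂ : Op L := prodZ (Finset.univ.image fun c : Fin L => hor 0 c)

variable (L) in
/-- The first logical `X`: the edges crossed by the straight horizontal loop through the cells of
the last row. -/
def logicalX₁ : Op L :=
  prodX (Finset.univ.image fun c : Fin L => ver (Fin.ofNat L (L - 1)) c)

variable (L) in
/-- The second logical `X`: the edges crossed by the vertically winding loop that follows the
snake from the cell `(0, L - 1)` to the cell `(L - 1, L - 1)` and is closed through the horizontal
edge `(0, L - 1)`. Like the first logical `X`, it avoids the comb. -/
def logicalX₂ : Op L :=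
  prodX (Finset.disjSum (Finset.univ.filter fun e => e.2 = turn e.1)
    (Finset.univ.filter fun e => e.2 ≠ 0 ∧ e.1 ≠ 0 ∧ (e.1.val ≠ L - 1 ∨ L % 2 = 1)))

variable (L) in
/-- The algebra of the two logical qubits. -/
def logicAlgebra : Subalgebra ℂ (Op L) :=
  Algebra.adjoin ℂ {logicalX₁ L, logicalZ₁ L, logicalX₂ L, logicalZ₂ L}

variable (L) in
/-- The syndrome algebra: it is generated by the magnetic part (plaquette observables and `σ^x`
on the snake) and the electric part (star observables and `σ^z` on the comb). -/
def syndromeAlgebra : Subalgebra ℂ (Op L) :=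
  Algebra.adjoin ℂ
    ((Set.range fun p : Fin L × Fin L => prodZ (plaquette p)) ∪ (sigmaX '' (snake L : Set (Spin L)))
      ∪ ((Set.range fun v : Fin L × Fin L => prodX (nodeStar v))
        ∪ (sigmaZ '' (comb L : Set (Spin L)))))

variable (L) in
/-- The local part of the Davies generator of the toric code: `σ^x` couplings on the snake and
`σ^z` couplings on the comb. -/
def localDavies (β : ℝ) : Op L →ₗ[ℂ] Op L :=
  ∑ j ∈ snake L, davies β (hamiltonian L) (sigmaX j) +
    ∑ j ∈ comb L, davies β (hamiltonian L) (sigmaZ j)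

end Toric

end ToricCode

end

/-!
The local generator is studied on the Pauli operators of the syndrome algebra, by duality with a
voter model.

A coupling `σ^x_j` flips exactly two plaquettes, so its Davies generator has only the Bohr
frequencies `4`, `0`, `-4`, and since the Glauber rates are `1 - δ`, `1`, `1 + δ` with
`δ = tanh (2 β)`, they are affine in the values of the two plaquettes (`FlipsPair.davies_apply`).
A spanning set of the syndrome algebra is given by the Pauli operators
`X ^ (η + ∑_{v ∈ B} s_v) Z ^ (ξ + ∑_{p ∈ A} p)` with `η` on the snake, `ξ` on the comb, `A` a set of
plaquettes and `B` a set of stars. The generator keeps `η` and `ξ`; an edge of the snake changes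
only `A`, and an edge of the comb only `B` (`CodeFrame.codeDavies_labelledPauli`, with the explicit
`edgeOp`). For `η = 0`, only the edges on the boundary of `A` act, and there an end point joins or
leaves `A` with rate `δ` each: a voter model on the tree, with killing at rate `2 (1 - δ)`.

An eigenvector of the transposed generator is a function `g` of `(A, B)`, for some `(η, ξ)`. If a
nonnegative weight `h`, which vanishes only where `g` has to, has drift at least `c h`, then a
comparison at the maximum of `|g| / h` gives real part at least `c` for the eigenvalue
(`le_re_of_edgeDrift`). The weights, chosen in `le_re_of_trees`, are as follows.
* If some but not all plaquettes anticommute with `X ^ η`, an edge between the two kinds damps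
  everything at rate at least `1 / 2`, and `h = 1` works; likewise for `ξ`.
* If all plaquettes anticommute, only `A = ∅` and the set of all plaquettes are not damped; from
  there every edge leads to damped sets, and it suffices to give them the weight `3 / 2`.
* If `η = 0` and `ξ = 0`, the killing gives `2 (1 - δ) ≥ 2 exp (-4 β)`, and the weight
  `|A| (n - |A|) + |B| (n - |B|)` with `n = L ^ 2` gives `2 / n ^ 2`, because `|A|` is a martingale
  of the voter model. It vanishes only on multiples of the identity.

The bound on the transposed generator also yields the kernel (`ker_eq_span_and_le_spectralGap`).
Only two properties of the snake and of the comb enter: they are connected and have no cycles.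

The tensor factorization is a relabelling of the computational basis: a configuration is determined
by the values of the two logical `Z` and by its projection to the configurations on which these
values are `1`, along the supports of the two logical `X` (`logicEquiv`). The two algebras are full
matrix algebras because they contain all translations, and diagonal matrices that separate the
points (`eq_top_of_translation_of_diagonal`).
-/

noncomputable section

namespace ToricCode

set_option linter.unusedSectionVars false

/-! ### Davies generators whose coupling splits into energy-shifting parts -/

section DaviesSplitting

variable {n : Type} [Fintype n] [DecidableEq n]

lemma toEuclideanLin_eigenProj (H : Matrix n n ℂ) (a : ℝ) (v : EuclideanSpace ℂ n) :
    Matrix.toEuclideanLin (eigenProj H a) v =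
      (Module.End.eigenspace (Matrix.toEuclideanLin H) (a : ℂ)).starProjection v := by
  simp [eigenProj]

lemma mul_eigenProj (H : Matrix n n ℂ) (a : ℝ) :
    H * eigenProj H a = (a : ℂ) • eigenProj H a := by
  apply Matrix.toEuclideanLin.injective
  ext1 v
  rw [Matrix.toLpLin_mul_same, LinearMap.comp_apply, toEuclideanLin_eigenProj, map_smul,
    LinearMap.smul_apply, toEuclideanLin_eigenProj]
  exact Module.End.mem_eigenspace_iff.mp (Submodule.starProjection_apply_mem _ v)

lemma isHermitian_eigenProj (H : Matrix n n ℂ) (a : ℝ) : (eigenProj H a).IsHermitian := by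
  rw [← Matrix.isSymmetric_toEuclideanLin_iff]
  intro v w
  rw [toEuclideanLin_eigenProj, toEuclideanLin_eigenProj]
  exact Submodule.inner_starProjection_left_eq_right _ v w

lemma eigenProj_mul {H : Matrix n n ℂ} (hH : H.IsHermitian) (a : ℝ) :
    eigenProj H a * H = (a : ℂ) • eigenProj H a := by
  have h := congrArg Matrix.conjTranspose (mul_eigenProj H a)
  rwa [Matrix.conjTranspose_mul, Matrix.conjTranspose_smul, (isHermitian_eigenProj H a).eq,
    hH.eq, Complex.star_def, Complex.conj_ofReal] at h

lemma sum_eigenProj {H : Matrix n n ℂ} (hH : H.IsHermitian) :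
    ∑ a ∈ spec H, eigenProj H a = 1 := by
  have hsym := Matrix.isSymmetric_toEuclideanLin_iff.mpr hH
  apply Matrix.toEuclideanLin.injective
  refine hH.eigenvectorBasis.toBasis.ext fun i => ?_
  have hev : hH.eigenvectorBasis i ∈
      Module.End.eigenspace (Matrix.toEuclideanLin H) (hH.eigenvalues i : ℂ) := by
    rw [Module.End.mem_eigenspace_iff, Matrix.toLpLin_apply, hH.mulVec_eigenvectorBasis i]
    ext j
    simp
  rw [OrthonormalBasis.coe_toBasis, map_sum, LinearMap.sum_apply,
    Finset.sum_eq_single (hH.eigenvalues i)]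
  · rw [toEuclideanLin_eigenProj, Submodule.starProjection_eq_self_iff.mpr hev,
      Matrix.toLpLin_one, LinearMap.id_apply]
  · intro b _ hb
    rw [toEuclideanLin_eigenProj, Submodule.starProjection_apply_eq_zero_iff,
      Submodule.mem_orthogonal]
    intro u hu
    exact hsym.orthogonalFamily_eigenspaces.pairwise (Complex.ofReal_injective.ne (Ne.symm hb))
      hev u hu
  · intro h
    exact absurd ((Set.Finite.mem_toFinset _).mpr (hH.eigenvalues_mem_spectrum_real i)) h

/-- An operator that raises the energy by exactly `k` connects only eigenspaces whose eigenvalues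
differ by `k`. -/
lemma eigenProj_mul_mul_eigenProj {H K : Matrix n n ℂ} (hH : H.IsHermitian) {k : ℝ}
    (hK : H * K - K * H = (k : ℂ) • K) {a b : ℝ} (hab : a - b ≠ k) :
    eigenProj H a * K * eigenProj H b = 0 := by
  have h : eigenProj H a * (H * K - K * H) * eigenProj H b =
      ((a - b : ℝ) : ℂ) • (eigenProj H a * K * eigenProj H b) := by
    rw [mul_sub, sub_mul, ← mul_assoc, eigenProj_mul hH, mul_assoc _ (K * H), mul_assoc K,
      mul_eigenProj]
    simp only [smul_mul_assoc, mul_smul_comm, mul_assoc, Complex.ofReal_sub, sub_smul]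
  rw [hK, mul_smul_comm, smul_mul_assoc, ← sub_eq_zero, ← sub_smul] at h
  refine (smul_eq_zero.mp h).resolve_left ?_
  rw [← Complex.ofReal_sub]
  exact_mod_cast sub_ne_zero.mpr (Ne.symm hab)

variable {H : Matrix n n ℂ} {F : Finset ℝ} {K : ℝ → Matrix n n ℂ}

/-- The Fourier components of an operator are determined by any splitting into parts that shift
the energy by distinct amounts. -/
lemma jump_sum (hH : H.IsHermitian) (hK : ∀ k ∈ F, H * K k - K k * H = (k : ℂ) • K k) (ω : ℝ) :
    jump H (∑ k ∈ F, K k) ω = if ω ∈ F then K ω else 0 := by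
  have h1 : jump H (∑ k ∈ F, K k) ω = ∑ k ∈ F, ∑ a ∈ spec H, ∑ b ∈ spec H,
      if k = ω then eigenProj H a * K k * eigenProj H b else 0 := by
    rw [Finset.sum_comm, jump]
    refine Finset.sum_congr rfl fun a _ => ?_
    rw [Finset.sum_comm]
    refine Finset.sum_congr rfl fun b _ => ?_
    rw [Finset.mul_sum, Finset.sum_mul,
      show ∀ f : ℝ → Matrix n n ℂ, (if a - b = ω then ∑ k ∈ F, f k else 0) =
        ∑ k ∈ F, if a - b = ω then f k else 0 from fun f => by split_ifs <;> simp]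
    refine Finset.sum_congr rfl fun k hk => ?_
    by_cases hab : a - b = k
    · rw [hab]
    · rw [eigenProj_mul_mul_eigenProj hH (hK k hk) hab, ite_self, ite_self]
  have h2 : ∀ k, ∑ a ∈ spec H, ∑ b ∈ spec H, eigenProj H a * K k * eigenProj H b = K k := by
    intro k
    simp_rw [← Finset.mul_sum, ← Finset.sum_mul, sum_eigenProj hH, one_mul, mul_one]
  rw [h1]
  have h3 : ∀ k ∈ F, (∑ a ∈ spec H, ∑ b ∈ spec H,
      if k = ω then eigenProj H a * K k * eigenProj H b else 0) = if k = ω then K k else 0 := by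
    intro k _
    split_ifs
    · exact h2 k
    · simp
  rw [Finset.sum_congr rfl h3, Finset.sum_ite_eq']

@[simp] lemma dissipator_zero : dissipator (0 : Matrix n n ℂ) = 0 := by
  ext1 A
  simp [dissipator]

lemma davies_sum (hH : H.IsHermitian) (hK : ∀ k ∈ F, H * K k - K k * H = (k : ℂ) • K k) (β : ℝ) :
    davies β H (∑ k ∈ F, K k) = ∑ k ∈ F, (glauber β k : ℂ) • dissipator (K k) := by
  have hzero : ∀ ω ∉ bohr H, jump H (∑ k ∈ F, K k) ω = 0 := by
    intro ω hω
    refine Finset.sum_eq_zero fun a ha => Finset.sum_eq_zero fun b hb => if_neg ?_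
    rintro rfl
    exact hω (Finset.mem_image₂_of_mem ha hb)
  rw [davies, Finset.sum_subset (Finset.subset_union_left (s₂ := F)) fun ω _ hω => by
      rw [hzero ω hω, dissipator_zero, smul_zero],
    ← Finset.sum_subset (Finset.subset_union_right (s₁ := bohr H)) fun ω _ hω => by
      rw [jump_sum hH hK, if_neg hω, dissipator_zero, smul_zero]]
  exact Finset.sum_congr rfl fun k hk => by rw [jump_sum hH hK, if_pos hk]

end DaviesSplitting

/-! ### The Davies generator of a coupling that flips two stabilizers -/

section EdgeCoupling

variable {n : Type} [Fintype n] [DecidableEq n]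

/-- The situation of a Pauli coupling `S` in the toric code: `S` is a self-adjoint involution that
flips the signs of exactly two terms `-Z₁` and `-Z₂` of the Hamiltonian `H`. -/
structure FlipsPair (H S Z₁ Z₂ : Matrix n n ℂ) : Prop where
  isHermitian : H.IsHermitian
  isHermitian_coupling : S.IsHermitian
  isHermitian₁ : Z₁.IsHermitian
  isHermitian₂ : Z₂.IsHermitian
  coupling_sq : S * S = 1
  sq₁ : Z₁ * Z₁ = 1
  sq₂ : Z₂ * Z₂ = 1
  comm : Z₂ * Z₁ = Z₁ * Z₂
  anti₁ : S * Z₁ = -(Z₁ * S)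
  anti₂ : S * Z₂ = -(Z₂ * S)
  comm₁ : H * Z₁ = Z₁ * H
  comm₂ : H * Z₂ = Z₂ * H
  shift : H * S - S * H = (2 : ℂ) • (S * (Z₁ + Z₂))

/-- The difference `tanh (2 β)` between the rate `1` of the moves that keep the energy and the rate
of the moves that create a pair of excitations, at energy cost `4`. -/
def tilt (β : ℝ) : ℝ := 1 - glauber β 4

lemma glauber_zero (β : ℝ) : glauber β 0 = 1 := by
  norm_num [glauber]

lemma glauber_four (β : ℝ) : glauber β 4 = 1 - tilt β := by
  rw [tilt, sub_sub_cancel]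

lemma glauber_neg_four (β : ℝ) : glauber β (-4) = 1 + tilt β := by
  have h : 0 < Real.exp (β * 4) := Real.exp_pos _
  rw [tilt, glauber, glauber, mul_neg, Real.exp_neg]
  field_simp
  ring

lemma exp_le_one_sub_tilt {β : ℝ} (hβ : 0 < β) : Real.exp (-(4 * β)) ≤ 1 - tilt β := by
  have h : 1 ≤ Real.exp (β * 4) := Real.one_le_exp (by positivity)
  rw [tilt, glauber, sub_sub_cancel, Real.exp_neg, mul_comm, inv_eq_one_div,
    div_le_div_iff₀ (by positivity) (by positivity)]
  linarith

lemma tilt_nonneg {β : ℝ} (hβ : 0 < β) : 0 ≤ tilt β := by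
  have h : 1 ≤ Real.exp (β * 4) := Real.one_le_exp (by positivity)
  rw [tilt, glauber, sub_nonneg, div_le_one (by positivity)]
  linarith

lemma tilt_le_one (β : ℝ) : tilt β ≤ 1 := by
  rw [tilt, glauber]
  linarith [show (0 : ℝ) ≤ 2 / (Real.exp (β * 4) + 1) by positivity]

namespace FlipsPair

variable {H S Z₁ Z₂ : Matrix n n ℂ}

lemma comm_assoc (h : FlipsPair H S Z₁ Z₂) (X : Matrix n n ℂ) :
    Z₂ * (Z₁ * X) = Z₁ * (Z₂ * X) := by
  rw [← mul_assoc, h.comm, mul_assoc]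

lemma sq₁_assoc (h : FlipsPair H S Z₁ Z₂) (X : Matrix n n ℂ) : Z₁ * (Z₁ * X) = X := by
  rw [← mul_assoc, h.sq₁, one_mul]

lemma sq₂_assoc (h : FlipsPair H S Z₁ Z₂) (X : Matrix n n ℂ) : Z₂ * (Z₂ * X) = X := by
  rw [← mul_assoc, h.sq₂, one_mul]

lemma coupling_sq_assoc (h : FlipsPair H S Z₁ Z₂) (X : Matrix n n ℂ) : S * (S * X) = X := by
  rw [← mul_assoc, h.coupling_sq, one_mul]

/-- The projection `(1 + x Z₁ + x Z₂ + Z₁ Z₂) / 4`, for `x = ± 1`, onto the common eigenspace of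
`Z₁` and `Z₂` for the eigenvalue `x`. -/
def alignedProj (Z₁ Z₂ : Matrix n n ℂ) (x : ℂ) : Matrix n n ℂ :=
  (1 / 4 : ℂ) • (1 + x • Z₁ + x • Z₂ + Z₁ * Z₂)

/-- The projection onto the states in which `Z₁` and `Z₂` have opposite signs. -/
def oppositeProj (Z₁ Z₂ : Matrix n n ℂ) : Matrix n n ℂ :=
  (1 / 2 : ℂ) • (1 - Z₁ * Z₂)

/-- The dissipator of the part `S Q` of the coupling. -/
lemma dissipator_mul (h : FlipsPair H S Z₁ Z₂) {Q : Matrix n n ℂ} (hQ : Q.IsHermitian)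
    (A : Matrix n n ℂ) :
    dissipator (S * Q) A =
      Q * (S * A * S) * Q - (1 / 2 : ℂ) • (Q * Q * A + A * (Q * Q)) := by
  simp only [dissipator, LinearMap.coe_mk, AddHom.coe_mk, Matrix.conjTranspose_mul, hQ.eq,
    h.isHermitian_coupling.eq, mul_assoc, h.coupling_sq_assoc]

lemma isHermitian_mul (h : FlipsPair H S Z₁ Z₂) : (Z₁ * Z₂).IsHermitian := by
  rw [Matrix.IsHermitian, Matrix.conjTranspose_mul, h.isHermitian₁.eq, h.isHermitian₂.eq, h.comm]

lemma isHermitian_alignedProj (h : FlipsPair H S Z₁ Z₂) {x : ℂ} (hx : star x = x) :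
    (alignedProj Z₁ Z₂ x).IsHermitian := by
  simp only [Matrix.IsHermitian, alignedProj, Matrix.conjTranspose_smul, Matrix.conjTranspose_add,
    Matrix.conjTranspose_one, h.isHermitian_mul.eq, h.isHermitian₁.eq, h.isHermitian₂.eq, hx]
  congr 1
  simp

lemma isHermitian_oppositeProj (h : FlipsPair H S Z₁ Z₂) :
    (oppositeProj Z₁ Z₂).IsHermitian := by
  simp only [Matrix.IsHermitian, oppositeProj, Matrix.conjTranspose_smul, Matrix.conjTranspose_sub,
    Matrix.conjTranspose_one, h.isHermitian_mul.eq]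
  congr 1
  simp

/-- If `Q` commutes with `H` and `Z₁ + Z₂` has the value `x` on it, then `S Q` raises the energy
by `2 x`. -/
lemma shift_mul (h : FlipsPair H S Z₁ Z₂) {Q : Matrix n n ℂ} (hQ : H * Q = Q * H) {x : ℂ}
    (hx : (Z₁ + Z₂) * Q = x • Q) : H * (S * Q) - S * Q * H = (2 * x) • (S * Q) := by
  rw [mul_assoc, ← hQ, ← mul_assoc, ← mul_assoc, ← sub_mul, h.shift, smul_mul_assoc, mul_assoc,
    hx, mul_smul_comm, smul_smul]

/-- The Davies generator of the coupling, with its three Bohr frequencies `4`, `0` and `-4`. -/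
lemma davies_apply (h : FlipsPair H S Z₁ Z₂) (β : ℝ) (A : Matrix n n ℂ) :
    davies β H S A =
      ((1 - tilt β : ℝ) : ℂ) • dissipator (S * alignedProj Z₁ Z₂ 1) A +
        (dissipator (S * oppositeProj Z₁ Z₂) A +
          ((1 + tilt β : ℝ) : ℂ) • dissipator (S * alignedProj Z₁ Z₂ (-1)) A) := by
  let K : ℝ → Matrix n n ℂ := fun k =>
    if k = 4 then S * alignedProj Z₁ Z₂ 1 else
      if k = 0 then S * oppositeProj Z₁ Z₂ else S * alignedProj Z₁ Z₂ (-1)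
  have hK₁ : K 4 = S * alignedProj Z₁ Z₂ 1 := by simp [K]
  have hK₂ : K 0 = S * oppositeProj Z₁ Z₂ := by simp [K]
  have hK₃ : K (-4) = S * alignedProj Z₁ Z₂ (-1) := by norm_num [K]
  have hne₁ : (4 : ℝ) ∉ ({0, -4} : Finset ℝ) := by norm_num
  have hne₂ : (0 : ℝ) ∉ ({-4} : Finset ℝ) := by norm_num
  have hH : ∀ x, H * alignedProj Z₁ Z₂ x = alignedProj Z₁ Z₂ x * H := fun x => by
    simp only [alignedProj, mul_smul_comm, smul_mul_assoc, mul_add, add_mul, mul_one, one_mul,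
      h.comm₁, h.comm₂, ← mul_assoc]
    simp only [mul_assoc, h.comm₂]
  have hH' : H * oppositeProj Z₁ Z₂ = oppositeProj Z₁ Z₂ * H := by
    simp only [oppositeProj, mul_smul_comm, smul_mul_assoc, mul_sub, sub_mul, mul_one, one_mul,
      h.comm₁, ← mul_assoc]
    simp only [mul_assoc, h.comm₂]
  have hsum : ∑ k ∈ ({4, 0, -4} : Finset ℝ), K k = S := by
    rw [Finset.sum_insert hne₁, Finset.sum_insert hne₂, Finset.sum_singleton, hK₁, hK₂, hK₃,
      ← mul_add, ← mul_add]
    convert mul_one S using 2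
    simp only [alignedProj, oppositeProj]
    module
  have hshift : ∀ k ∈ ({4, 0, -4} : Finset ℝ), H * K k - K k * H = (k : ℂ) • K k := by
    simp only [Finset.mem_insert, Finset.mem_singleton, forall_eq_or_imp, forall_eq]
    refine ⟨?_, ?_, ?_⟩
    · rw [hK₁, h.shift_mul (hH 1) (x := 2)]
      · norm_num
      · simp only [alignedProj, mul_smul_comm, mul_add, add_mul, mul_one, h.sq₁, h.sq₂, h.comm,
          h.sq₁_assoc, h.comm_assoc]
        module
    · rw [hK₂, h.shift_mul hH' (x := 0)]
      · norm_num
      · simp only [oppositeProj, mul_smul_comm, mul_sub, add_mul, mul_one, h.sq₂,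
          h.sq₁_assoc, h.comm_assoc]
        module
    · rw [hK₃, h.shift_mul (hH (-1)) (x := -2)]
      · norm_num
      · simp only [alignedProj, mul_smul_comm, mul_add, add_mul, mul_one, h.sq₁, h.sq₂, h.comm,
          h.sq₁_assoc, h.comm_assoc]
        module
  conv_lhs => rw [← hsum]
  rw [davies_sum h.isHermitian hshift, Finset.sum_insert hne₁, Finset.sum_insert hne₂,
    Finset.sum_singleton, hK₁, hK₂, hK₃, glauber_zero, glauber_four, glauber_neg_four]
  simp

/-- The generator maps every subalgebra that contains the coupling and the two stabilizers into
itself. -/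
lemma davies_mem (h : FlipsPair H S Z₁ Z₂) (β : ℝ) {𝒜 : Subalgebra ℂ (Matrix n n ℂ)}
    (hS : S ∈ 𝒜) (h₁ : Z₁ ∈ 𝒜) (h₂ : Z₂ ∈ 𝒜) {A : Matrix n n ℂ} (hA : A ∈ 𝒜) :
    davies β H S A ∈ 𝒜 := by
  have hd : ∀ {Q : Matrix n n ℂ}, Q.IsHermitian → Q ∈ 𝒜 → dissipator (S * Q) A ∈ 𝒜 := by
    intro Q hQ hmem
    rw [h.dissipator_mul hQ]
    have hQQ := mul_mem hmem hmem
    exact sub_mem (mul_mem (mul_mem hmem (mul_mem (mul_mem hS hA) hS)) hmem)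
      (𝒜.smul_mem (add_mem (mul_mem hQQ hA) (mul_mem hA hQQ)) _)
  have ha : ∀ x, alignedProj Z₁ Z₂ x ∈ 𝒜 := fun x =>
    𝒜.smul_mem (add_mem (add_mem (add_mem (one_mem _) (𝒜.smul_mem h₁ _)) (𝒜.smul_mem h₂ _))
      (mul_mem h₁ h₂)) _
  rw [h.davies_apply]
  refine add_mem (𝒜.smul_mem (hd (h.isHermitian_alignedProj (by simp)) (ha _)) _)
    (add_mem (hd h.isHermitian_oppositeProj ?_)
      (𝒜.smul_mem (hd (h.isHermitian_alignedProj (by simp)) (ha _)) _))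
  exact 𝒜.smul_mem (sub_mem (one_mem _) (mul_mem h₁ h₂)) _

/-- The generator is linear over the commutant of the coupling and the two stabilizers. -/
lemma davies_mul_left (h : FlipsPair H S Z₁ Z₂) (β : ℝ) {X : Matrix n n ℂ}
    (hS : Commute X S) (h₁ : Commute X Z₁) (h₂ : Commute X Z₂) (A : Matrix n n ℂ) :
    davies β H S (X * A) = X * davies β H S A := by
  have hd : ∀ {Q : Matrix n n ℂ}, Q.IsHermitian → Commute X Q →
      dissipator (S * Q) (X * A) = X * dissipator (S * Q) A := by
    intro Q hQ hX
    rw [h.dissipator_mul hQ, h.dissipator_mul hQ, mul_sub, mul_smul_comm, mul_add]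
    have e₁ : Q * (S * (X * A) * S) * Q = X * (Q * (S * A * S) * Q) := by
      rw [← mul_assoc S X, ← hS.eq, mul_assoc X, mul_assoc X, ← mul_assoc Q X, ← hX.eq,
        mul_assoc X, mul_assoc X]
    have e₂ : Q * Q * (X * A) = X * (Q * Q * A) := by
      rw [← mul_assoc, ← (hX.mul_right hX).eq, mul_assoc]
    rw [e₁, e₂, mul_assoc X A]
  have ha : ∀ x, Commute X (alignedProj Z₁ Z₂ x) := fun x =>
    ((((Commute.one_right X).add_right (h₁.smul_right x)).add_right (h₂.smul_right x)).add_right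
      (h₁.mul_right h₂)).smul_right _
  have ho : Commute X (oppositeProj Z₁ Z₂) :=
    ((Commute.one_right X).sub_right (h₁.mul_right h₂)).smul_right _
  rw [h.davies_apply, h.davies_apply, hd (h.isHermitian_alignedProj (by simp)) (ha _),
    hd h.isHermitian_oppositeProj ho, hd (h.isHermitian_alignedProj (by simp)) (ha _)]
  simp only [mul_add, mul_smul_comm]

variable {P : Matrix n n ℂ} {s : ℂ}

lemma conj_coupling (h : FlipsPair H S Z₁ Z₂) (hs : S * P = s • (P * S)) : S * P * S = s • P := by
  rw [hs, smul_mul_assoc, mul_assoc, h.coupling_sq, mul_one]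

/-- The generator on an operator that commutes with both stabilizers. -/
lemma davies_comm_comm (h : FlipsPair H S Z₁ Z₂) (β : ℝ) (hs : S * P = s • (P * S))
    (h₁ : P * Z₁ = Z₁ * P) (h₂ : P * Z₂ = Z₂ * P) :
    davies β H S P = (s - 1) • (P - (tilt β / 2 : ℂ) • (Z₁ * P + Z₂ * P)) := by
  have h₁' : ∀ X, P * (Z₁ * X) = Z₁ * (P * X) := fun X => by rw [← mul_assoc, h₁, mul_assoc]
  rw [h.davies_apply, h.dissipator_mul (h.isHermitian_alignedProj (by simp)),
    h.dissipator_mul h.isHermitian_oppositeProj,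
    h.dissipator_mul (h.isHermitian_alignedProj (by simp)), h.conj_coupling hs]
  simp only [alignedProj, oppositeProj, mul_add, add_mul, mul_sub, sub_mul, mul_smul_comm,
    smul_mul_assoc, mul_assoc, mul_one, one_mul, h.sq₁, h.sq₂, h.comm, h.sq₁_assoc, h.sq₂_assoc,
    h.comm_assoc, h₁, h₂, h₁']
  push_cast
  module

/-- The generator on an operator that anticommutes with the first stabilizer only. -/
lemma davies_anti_comm (h : FlipsPair H S Z₁ Z₂) (β : ℝ) (hs : S * P = s • (P * S))
    (h₁ : P * Z₁ = -(Z₁ * P)) (h₂ : P * Z₂ = Z₂ * P) :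
    davies β H S P = -(P - (tilt β / 2 : ℂ) • (Z₂ * P)) := by
  have h₁' : ∀ X, P * (Z₁ * X) = -(Z₁ * (P * X)) := fun X => by
    rw [← mul_assoc, h₁, neg_mul, mul_assoc]
  rw [h.davies_apply, h.dissipator_mul (h.isHermitian_alignedProj (by simp)),
    h.dissipator_mul h.isHermitian_oppositeProj,
    h.dissipator_mul (h.isHermitian_alignedProj (by simp)), h.conj_coupling hs]
  simp only [alignedProj, oppositeProj, mul_add, add_mul, mul_sub, sub_mul, mul_smul_comm,
    smul_mul_assoc, mul_assoc, mul_one, one_mul, h.sq₁, h.sq₂, h.comm, h.sq₁_assoc, h.sq₂_assoc,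
    h.comm_assoc, h₁, h₂, h₁', mul_neg]
  push_cast
  module

lemma symm (h : FlipsPair H S Z₁ Z₂) : FlipsPair H S Z₂ Z₁ where
  isHermitian := h.isHermitian
  isHermitian_coupling := h.isHermitian_coupling
  isHermitian₁ := h.isHermitian₂
  isHermitian₂ := h.isHermitian₁
  coupling_sq := h.coupling_sq
  sq₁ := h.sq₂
  sq₂ := h.sq₁
  comm := h.comm.symm
  anti₁ := h.anti₂
  anti₂ := h.anti₁
  comm₁ := h.comm₂
  comm₂ := h.comm₁
  shift := by rw [h.shift, add_comm]

/-- The generator on an operator that anticommutes with both stabilizers. -/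
lemma davies_anti_anti (h : FlipsPair H S Z₁ Z₂) (β : ℝ) (hs : S * P = s • (P * S))
    (h₁ : P * Z₁ = -(Z₁ * P)) (h₂ : P * Z₂ = -(Z₂ * P)) :
    davies β H S P = -((1 - s / 2) • P + (s / 2) • (Z₁ * (Z₂ * P))) := by
  have h₁' : ∀ X, P * (Z₁ * X) = -(Z₁ * (P * X)) := fun X => by
    rw [← mul_assoc, h₁, neg_mul, mul_assoc]
  rw [h.davies_apply, h.dissipator_mul (h.isHermitian_alignedProj (by simp)),
    h.dissipator_mul h.isHermitian_oppositeProj,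
    h.dissipator_mul (h.isHermitian_alignedProj (by simp)), h.conj_coupling hs]
  simp only [alignedProj, oppositeProj, mul_add, add_mul, mul_sub, sub_mul, mul_smul_comm,
    smul_mul_assoc, mul_assoc, mul_one, one_mul, h.sq₁, h.sq₂, h.comm, h.sq₁_assoc, h.sq₂_assoc,
    h.comm_assoc, h₁, h₂, h₁', mul_neg]
  push_cast
  module

end FlipsPair

end EdgeCoupling

/-! ### Pauli operators -/

section Pauli

/-- The sign `(-1) ^ x` of a bit `x`. -/
def sgn (x : ZMod 2) : ℂ := if x = 0 then 1 else -1

lemma zmod_two_cases (x : ZMod 2) : x = 0 ∨ x = 1 := by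
  revert x; decide

@[simp] lemma sgn_zero : sgn 0 = 1 := if_pos rfl

@[simp] lemma sgn_one : sgn 1 = -1 := if_neg one_ne_zero

lemma sgn_add (x y : ZMod 2) : sgn (x + y) = sgn x * sgn y := by
  have h : (1 + 1 : ZMod 2) = 0 := rfl
  obtain rfl | rfl := zmod_two_cases x <;> obtain rfl | rfl := zmod_two_cases y <;> simp [h]

@[simp] lemma sgn_mul_self (x : ZMod 2) : sgn x * sgn x = 1 := by
  obtain rfl | rfl := zmod_two_cases x <;> simp

lemma star_sgn (x : ZMod 2) : star (sgn x) = sgn x := by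
  obtain rfl | rfl := zmod_two_cases x <;> simp

lemma sgn_injective : Function.Injective sgn := by
  intro x y h
  obtain rfl | rfl := zmod_two_cases x <;> obtain rfl | rfl := zmod_two_cases y <;>
    first | rfl | (norm_num at h)

variable {ι : Type} [Fintype ι] [DecidableEq ι]

/-- The Pauli operator `X ^ τ Z ^ χ` on the qubits `ι`: first the signs `(-1) ^ (χ ⬝ t)`, then the
translation by `τ`. -/
def pauli (τ χ : ι → ZMod 2) : Matrix (ι → ZMod 2) (ι → ZMod 2) ℂ :=
  Matrix.of fun s t => if s = t + τ then sgn (χ ⬝ᵥ t) else 0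

lemma pauli_apply (τ χ s t : ι → ZMod 2) :
    pauli τ χ s t = if s = t + τ then sgn (χ ⬝ᵥ t) else 0 := rfl

lemma pauli_mul (τ χ τ' χ' : ι → ZMod 2) :
    pauli τ χ * pauli τ' χ' = sgn (χ ⬝ᵥ τ') • pauli (τ + τ') (χ + χ') := by
  ext s t
  rw [Matrix.mul_apply, Finset.sum_eq_single (t + τ')]
  · rw [Matrix.smul_apply]
    simp only [pauli_apply, if_true, dotProduct_add, add_dotProduct, sgn_add, smul_eq_mul,
      add_assoc, add_comm τ']
    split_ifs
    · ring
    · simp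
  · intro u _ hu
    rw [pauli_apply τ', if_neg hu, mul_zero]
  · simp

@[simp] lemma pauli_zero_zero : pauli (0 : ι → ZMod 2) 0 = 1 := by
  ext s t
  simp [pauli_apply, Matrix.one_apply]

lemma pauli_add_left (τ τ' : ι → ZMod 2) : pauli (τ + τ') 0 = pauli τ 0 * pauli τ' 0 := by
  simp [pauli_mul]

lemma pauli_add_right (χ χ' : ι → ZMod 2) : pauli 0 (χ + χ') = pauli 0 χ * pauli 0 χ' := by
  simp [pauli_mul]

lemma pauli_eq_mul (τ χ : ι → ZMod 2) : pauli τ χ = pauli τ 0 * pauli 0 χ := by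
  simp [pauli_mul]

lemma pauli_mul_comm (τ χ τ' χ' : ι → ZMod 2) :
    pauli τ χ * pauli τ' χ' = sgn (χ ⬝ᵥ τ' + χ' ⬝ᵥ τ) • (pauli τ' χ' * pauli τ χ) := by
  rw [pauli_mul, pauli_mul, smul_smul, sgn_add, mul_assoc, sgn_mul_self, mul_one, add_comm τ,
    add_comm χ]

lemma pauli_commute {τ χ τ' χ' : ι → ZMod 2} (h : χ ⬝ᵥ τ' + χ' ⬝ᵥ τ = 0) :
    pauli τ χ * pauli τ' χ' = pauli τ' χ' * pauli τ χ := by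
  rw [pauli_mul_comm, h, sgn_zero, one_smul]

lemma pauli_anticommute {τ χ τ' χ' : ι → ZMod 2} (h : χ ⬝ᵥ τ' + χ' ⬝ᵥ τ = 1) :
    pauli τ χ * pauli τ' χ' = -(pauli τ' χ' * pauli τ χ) := by
  rw [pauli_mul_comm, h, sgn_one, neg_one_smul]

lemma add_self_zmod_two {α : Type} (x : α → ZMod 2) : x + x = 0 :=
  funext fun i => CharTwo.add_self_eq_zero (x i)

lemma pauli_mul_self {τ χ : ι → ZMod 2} (h : χ ⬝ᵥ τ = 0) : pauli τ χ * pauli τ χ = 1 := by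
  rw [pauli_mul, h, sgn_zero, one_smul, add_self_zmod_two, add_self_zmod_two, pauli_zero_zero]

lemma isHermitian_pauli {τ χ : ι → ZMod 2} (h : χ ⬝ᵥ τ = 0) : (pauli τ χ).IsHermitian := by
  ext s t
  rw [Matrix.conjTranspose_apply, pauli_apply, pauli_apply]
  have hiff : t = s + τ ↔ s = t + τ := by
    constructor <;> rintro rfl <;> rw [add_assoc, add_self_zmod_two, add_zero]
  by_cases hst : s = t + τ
  · rw [if_pos hst, if_pos (hiff.mpr hst), star_sgn, hst, dotProduct_add, h, add_zero]
  · rw [if_neg hst, if_neg (mt hiff.mp hst), star_zero]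

/-- In a Hamiltonian `-∑ₖ Gₖ` of commuting Pauli operators, a Pauli operator that anticommutes with
exactly two of the `Gₖ` flips this pair. -/
lemma flipsPair_pauli {κ : Type} [Fintype κ] [DecidableEq κ] {a b : κ → ι → ZMod 2}
    (hself : ∀ k, b k ⬝ᵥ a k = 0) (hcomm : ∀ k l, b k ⬝ᵥ a l + b l ⬝ᵥ a k = 0)
    {τ χ : ι → ZMod 2} (hS : χ ⬝ᵥ τ = 0) {k₁ k₂ : κ} (hne : k₁ ≠ k₂)
    (h₁ : χ ⬝ᵥ a k₁ + b k₁ ⬝ᵥ τ = 1) (h₂ : χ ⬝ᵥ a k₂ + b k₂ ⬝ᵥ τ = 1)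
    (h : ∀ k, k ≠ k₁ → k ≠ k₂ → χ ⬝ᵥ a k + b k ⬝ᵥ τ = 0) :
    FlipsPair (-∑ k, pauli (a k) (b k)) (pauli τ χ) (pauli (a k₁) (b k₁))
      (pauli (a k₂) (b k₂)) where
  isHermitian := by
    rw [Matrix.IsHermitian, Matrix.conjTranspose_neg, Matrix.conjTranspose_sum]
    exact congrArg Neg.neg (Finset.sum_congr rfl fun k _ => isHermitian_pauli (hself k))
  isHermitian_coupling := isHermitian_pauli hS
  isHermitian₁ := isHermitian_pauli (hself _)
  isHermitian₂ := isHermitian_pauli (hself _)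
  coupling_sq := pauli_mul_self hS
  sq₁ := pauli_mul_self (hself _)
  sq₂ := pauli_mul_self (hself _)
  comm := pauli_commute (hcomm _ _)
  anti₁ := pauli_anticommute h₁
  anti₂ := pauli_anticommute h₂
  comm₁ := by
    rw [neg_mul, mul_neg, Finset.sum_mul, Finset.mul_sum]
    exact congrArg Neg.neg (Finset.sum_congr rfl fun k _ => pauli_commute (hcomm _ _))
  comm₂ := by
    rw [neg_mul, mul_neg, Finset.sum_mul, Finset.mul_sum]
    exact congrArg Neg.neg (Finset.sum_congr rfl fun k _ => pauli_commute (hcomm _ _))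
  shift := by
    rw [neg_mul, mul_neg, Finset.sum_mul, Finset.mul_sum, sub_neg_eq_add, neg_add_eq_sub,
      ← Finset.sum_sub_distrib, ← Finset.sum_subset (Finset.subset_univ {k₁, k₂}),
      Finset.sum_pair hne, pauli_anticommute h₁, pauli_anticommute h₂, mul_add,
      pauli_anticommute h₁, pauli_anticommute h₂]
    · module
    · intro k _ hk
      simp only [Finset.mem_insert, Finset.mem_singleton, not_or] at hk
      rw [pauli_commute (h k hk.1 hk.2), sub_self]

end Pauli

/-! ### The generator on Pauli operators: one edge -/

section EdgeOperator

variable {V : Type} [DecidableEq V]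

/-- The negative of the generator of an edge with end points `p` and `q`, on a family `g` of Pauli
operators labelled by sets `A` of vertices (as indicator functions); adding a vertex to `A` means
multiplying with its stabilizer. The function `a` tells which stabilizers anticommute with the
family. On a family that commutes with the stabilizers, the edge lets `A` evolve only if it is a
boundary edge of `A`: then one end point joins or leaves `A`, as in the voter model. -/
def edgeOp {M : Type} [AddCommGroup M] [Module ℂ M] (δ : ℝ) (a : V → ZMod 2) (p q : V)
    (g : (V → ZMod 2) → M) (A : V → ZMod 2) : M :=
  if a p = 0 then
    if a q = 0 then
      (1 - sgn (A p + A q)) •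
        (g A - (δ / 2 : ℂ) • (g (A + Pi.single p 1) + g (A + Pi.single q 1)))
    else g A - (δ / 2 : ℂ) • g (A + Pi.single p 1)
  else
    if a q = 0 then g A - (δ / 2 : ℂ) • g (A + Pi.single q 1)
    else (1 - sgn (A p + A q) / 2) • g A +
      (sgn (A p + A q) / 2) • g (A + Pi.single q 1 + Pi.single p 1)

lemma map_edgeOp {M N : Type} [AddCommGroup M] [Module ℂ M] [AddCommGroup N] [Module ℂ N]
    (f : M →ₗ[ℂ] N) (δ : ℝ) (a : V → ZMod 2) (p q : V) (g : (V → ZMod 2) → M)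
    (A : V → ZMod 2) : f (edgeOp δ a p q g A) = edgeOp δ a p q (fun A => f (g A)) A := by
  unfold edgeOp
  split_ifs <;> simp

variable {n : Type} [Fintype n] [DecidableEq n]

lemma FlipsPair.davies_eq_edgeOp {H S Z₁ Z₂ : Matrix n n ℂ} (h : FlipsPair H S Z₁ Z₂) (β : ℝ)
    {a : V → ZMod 2} {p q : V} {g : (V → ZMod 2) → Matrix n n ℂ} {A : V → ZMod 2}
    (hs : S * g A = sgn (A p + A q) • (g A * S))
    (h₁ : g A * Z₁ = sgn (a p) • (Z₁ * g A)) (h₂ : g A * Z₂ = sgn (a q) • (Z₂ * g A))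
    {c₁ c₂ : ℂ} (hc₁ : a p = 0 → c₁ = 1) (hc₂ : a q = 0 → c₂ = 1)
    (hc : a p = a q → c₂ * c₁ = 1) (hg₁ : ∀ A, Z₁ * g A = c₁ • g (A + Pi.single p 1))
    (hg₂ : ∀ A, Z₂ * g A = c₂ • g (A + Pi.single q 1)) :
    davies β H S (g A) = -edgeOp (tilt β) a p q g A := by
  unfold edgeOp
  obtain hp | hp := zmod_two_cases (a p) <;> obtain hq | hq := zmod_two_cases (a q)
  · rw [hp, sgn_zero, one_smul] at h₁
    rw [hq, sgn_zero, one_smul] at h₂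
    rw [if_pos hp, if_pos hq, h.davies_comm_comm β hs h₁ h₂, hg₁, hg₂, hc₁ hp, hc₂ hq]
    module
  · rw [hp, sgn_zero, one_smul] at h₁
    rw [hq, sgn_one, neg_one_smul] at h₂
    rw [if_pos hp, if_neg (by simp [hq]), h.symm.davies_anti_comm β hs h₂ h₁, hg₁, hc₁ hp, one_smul]
  · rw [hp, sgn_one, neg_one_smul] at h₁
    rw [hq, sgn_zero, one_smul] at h₂
    rw [if_neg (by simp [hp]), if_pos hq, h.davies_anti_comm β hs h₁ h₂, hg₂, hc₂ hq, one_smul]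
  · rw [hp, sgn_one, neg_one_smul] at h₁
    rw [hq, sgn_one, neg_one_smul] at h₂
    rw [if_neg (by simp [hp]), if_neg (by simp [hq]), h.davies_anti_anti β hs h₁ h₂, hg₂,
      mul_smul_comm, hg₁, smul_smul c₂, hc (hp.trans hq.symm), one_smul]

end EdgeOperator

/-! ### Lyapunov weights -/

section Drift

variable {V : Type} [DecidableEq V]

/-- The counterpart of `edgeOp` for a nonnegative weight `h`: all off-diagonal terms are counted
with a minus sign. -/
def edgeDrift (δ : ℝ) (a : V → ZMod 2) (p q : V) (h : (V → ZMod 2) → ℝ) (A : V → ZMod 2) : ℝ :=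
  if a p = 0 then
    if a q = 0 then
      if A p = A q then 0
      else 2 * h A - δ * (h (A + Pi.single p 1) + h (A + Pi.single q 1))
    else h A - δ / 2 * h (A + Pi.single p 1)
  else
    if a q = 0 then h A - δ / 2 * h (A + Pi.single q 1)
    else if A p = A q then (h A - h (A + Pi.single q 1 + Pi.single p 1)) / 2
    else (3 * h A - h (A + Pi.single q 1 + Pi.single p 1)) / 2

lemma edgeDrift_add_const (δ : ℝ) (a : V → ZMod 2) (p q : V) (h : (V → ZMod 2) → ℝ) (k : ℝ)
    (A : V → ZMod 2) :
    edgeDrift δ a p q (fun A => h A + k) A =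
      edgeDrift δ a p q h A + edgeDrift δ a p q (fun _ => k) A := by
  unfold edgeDrift
  split_ifs <;> ring

lemma edgeDrift_const_nonneg {δ : ℝ} (hδ₀ : 0 ≤ δ) (hδ₁ : δ ≤ 1) (a : V → ZMod 2) (p q : V)
    {k : ℝ} (hk : 0 ≤ k) (A : V → ZMod 2) : 0 ≤ edgeDrift δ a p q (fun _ => k) A := by
  unfold edgeDrift
  have := mul_nonneg hδ₀ hk
  have := mul_nonneg (sub_nonneg.mpr hδ₁) hk
  split_ifs <;> linarith

lemma half_le_edgeDrift_one {δ : ℝ} (hδ₁ : δ ≤ 1) {a : V → ZMod 2} {p q : V} (ha : a p ≠ a q)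
    (A : V → ZMod 2) : 1 / 2 ≤ edgeDrift δ a p q (fun _ => 1) A := by
  unfold edgeDrift
  obtain hp | hp := zmod_two_cases (a p) <;> obtain hq | hq := zmod_two_cases (a q) <;>
    simp [hp, hq] at ha ⊢ <;> linarith

lemma edgeDrift_le_re {δ : ℝ} (hδ : 0 ≤ δ) (a : V → ZMod 2) (p q : V)
    {g : (V → ZMod 2) → ℂ} {h : (V → ZMod 2) → ℝ} {R : ℝ} (hg : ∀ A, ‖g A‖ ≤ R * h A)
    {A : V → ZMod 2} (hA : ‖g A‖ = R * h A) :
    R ^ 2 * h A * edgeDrift δ a p q h A ≤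
      (starRingEnd ℂ (g A) * edgeOp δ a p q g A).re := by
  have h0 : (starRingEnd ℂ (g A) * g A).re = R * h A * (R * h A) := by
    rw [mul_comm, Complex.mul_conj, Complex.ofReal_re, Complex.normSq_eq_norm_sq, hA, sq]
  have hb : ∀ A', |(starRingEnd ℂ (g A) * g A').re| ≤ R * h A * (R * h A') := fun A' => by
    refine (Complex.abs_re_le_norm _).trans ?_
    rw [norm_mul, RCLike.norm_conj, hA]
    exact mul_le_mul_of_nonneg_left (hg A') (hA ▸ norm_nonneg _)
  have hb₁ := hb (A + Pi.single p 1)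
  have hb₂ := hb (A + Pi.single q 1)
  have hb₃ := hb (A + Pi.single q 1 + Pi.single p 1)
  rw [abs_le] at hb₁ hb₂ hb₃
  have hre : ∀ (x : ℝ) (z : ℂ), (starRingEnd ℂ (g A) * ((x : ℂ) * z)).re =
      x * (starRingEnd ℂ (g A) * z).re := fun x z => by
    rw [mul_left_comm, Complex.re_ofReal_mul]
  have e₁ := mul_le_mul_of_nonneg_left hb₁.2 hδ
  have e₂ := mul_le_mul_of_nonneg_left hb₂.2 hδ
  unfold edgeDrift edgeOp
  have hs : sgn (A p + A q) = ((if A p = A q then 1 else -1 : ℝ) : ℂ) := by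
    obtain hp | hp := zmod_two_cases (A p) <;> obtain hq | hq := zmod_two_cases (A q) <;>
      simp [hp, hq, show (1 + 1 : ZMod 2) = 0 from rfl]
  rw [hs]
  split_ifs
  · simp
  · have hd : ((1 : ℂ) - ((-1 : ℝ) : ℂ)) • (g A - (δ / 2 : ℂ) •
        (g (A + Pi.single p 1) + g (A + Pi.single q 1))) =
        ((2 : ℝ) : ℂ) * g A - ((δ : ℝ) : ℂ) * (g (A + Pi.single p 1)) -
          ((δ : ℝ) : ℂ) * (g (A + Pi.single q 1)) := by
      simp only [smul_eq_mul]; push_cast; ring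
    rw [hd]
    simp only [mul_sub, Complex.sub_re, hre, h0]
    linarith
  · have hd : g A - (δ / 2 : ℂ) • g (A + Pi.single p 1) =
        g A - ((δ / 2 : ℝ) : ℂ) * (g (A + Pi.single p 1)) := by
      simp only [smul_eq_mul]; push_cast; ring
    rw [hd]
    simp only [mul_sub, Complex.sub_re, hre, h0]
    linarith
  · have hd : g A - (δ / 2 : ℂ) • g (A + Pi.single q 1) =
        g A - ((δ / 2 : ℝ) : ℂ) * (g (A + Pi.single q 1)) := by
      simp only [smul_eq_mul]; push_cast; ring
    rw [hd]
    simp only [mul_sub, Complex.sub_re, hre, h0]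
    linarith
  · have hd : ((1 : ℂ) - ((1 : ℝ) : ℂ) / 2) • g A + (((1 : ℝ) : ℂ) / 2) •
        g (A + Pi.single q 1 + Pi.single p 1) =
        ((1 / 2 : ℝ) : ℂ) * g A + ((1 / 2 : ℝ) : ℂ) *
          g (A + Pi.single q 1 + Pi.single p 1) := by
      simp only [smul_eq_mul]; push_cast; ring
    rw [hd]
    simp only [mul_add, Complex.add_re, hre, h0]
    linarith
  · have hd : ((1 : ℂ) - ((-1 : ℝ) : ℂ) / 2) • g A + (((-1 : ℝ) : ℂ) / 2) •
        g (A + Pi.single q 1 + Pi.single p 1) =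
        ((3 / 2 : ℝ) : ℂ) * g A + ((-1 / 2 : ℝ) : ℂ) *
          g (A + Pi.single q 1 + Pi.single p 1) := by
      simp only [smul_eq_mul]; push_cast; ring
    rw [hd]
    simp only [mul_add, Complex.add_re, hre, h0]
    linarith

variable [Fintype V] {ι κ : Type}

/-- An eigenvalue of a sum of edge operators, acting on pairs `(A, B)`, is bounded below in terms of
any weight `h` with drift at least `c h`: compare at a pair where `‖g‖ / h` is maximal. -/
lemma le_re_of_edgeDrift {δ : ℝ} (hδ : 0 ≤ δ) {J : Finset ι} {J' : Finset κ} {a a' : V → ZMod 2}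
    {p q : ι → V} {p' q' : κ → V} {z : ℂ} {g : (V → ZMod 2) → (V → ZMod 2) → ℂ}
    (hg : ∀ A B, z * g A B = ∑ j ∈ J, edgeOp δ a (p j) (q j) (fun A => g A B) A +
      ∑ j ∈ J', edgeOp δ a' (p' j) (q' j) (g A) B)
    (hg₀ : ∃ A B, g A B ≠ 0) {h : (V → ZMod 2) → (V → ZMod 2) → ℝ} (hh : ∀ A B, 0 ≤ h A B)
    (hh₀ : ∀ A B, h A B = 0 → g A B = 0) {c : ℝ}
    (hc : ∀ A B, c * h A B ≤ ∑ j ∈ J, edgeDrift δ a (p j) (q j) (fun A => h A B) A +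
      ∑ j ∈ J', edgeDrift δ a' (p' j) (q' j) (h A) B) : c ≤ z.re := by
  obtain ⟨⟨A, B⟩, hmax⟩ := Finite.exists_max
    fun x : (V → ZMod 2) × (V → ZMod 2) => ‖g x.1 x.2‖ / h x.1 x.2
  have hpos : 0 < ‖g A B‖ / h A B := by
    obtain ⟨A', B', hne⟩ := hg₀
    have h' : 0 < h A' B' := (hh A' B').lt_of_ne fun h0 => hne (hh₀ _ _ h0.symm)
    exact (div_pos (norm_pos_iff.mpr hne) h').trans_le (hmax (A', B'))
  have hAB : 0 < h A B := (hh A B).lt_of_ne fun h0 => by simp [← h0] at hpos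
  generalize hR : ‖g A B‖ / h A B = R at hpos hmax
  have heq : ‖g A B‖ = R * h A B := by rw [← hR, div_mul_cancel₀ _ hAB.ne']
  have hle : ∀ A' B', ‖g A' B'‖ ≤ R * h A' B' := fun A' B' => by
    rcases (hh A' B').eq_or_lt with h0 | h0
    · rw [hh₀ A' B' h0.symm, ← h0]
      simp
    · exact (div_le_iff₀ h0).mp (hmax (A', B'))
  have hsum : R ^ 2 * h A B * (∑ j ∈ J, edgeDrift δ a (p j) (q j) (fun A => h A B) A +
      ∑ j ∈ J', edgeDrift δ a' (p' j) (q' j) (h A) B) ≤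
      (starRingEnd ℂ (g A B) * (z * g A B)).re := by
    rw [hg A B, mul_add, mul_add, Finset.mul_sum, Finset.mul_sum, Finset.mul_sum, Finset.mul_sum,
      Complex.add_re, Complex.re_sum, Complex.re_sum]
    refine add_le_add (Finset.sum_le_sum fun j _ => ?_) (Finset.sum_le_sum fun j _ => ?_)
    · exact edgeDrift_le_re (g := fun A => g A B) (h := fun A => h A B) hδ a _ _
        (fun A' => hle A' B) heq
    · exact edgeDrift_le_re hδ a' _ _ (hle A) heq
  have hre : (starRingEnd ℂ (g A B) * (z * g A B)).re = z.re * (R * h A B) ^ 2 := by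
    rw [mul_left_comm, mul_comm (starRingEnd ℂ _), Complex.mul_conj, Complex.normSq_eq_norm_sq,
      heq, Complex.re_mul_ofReal]
  rw [hre] at hsum
  have hmul := mul_le_mul_of_nonneg_left (hc A B) (mul_pos (pow_pos hpos 2) hAB).le
  have : c * (R * h A B) ^ 2 ≤ z.re * (R * h A B) ^ 2 := by
    calc c * (R * h A B) ^ 2 = R ^ 2 * h A B * (c * h A B) := by ring
      _ ≤ _ := hmul.trans hsum
  exact le_of_mul_le_mul_right this (by positivity)

end Drift

/-! ### Drift estimates on a tree -/

section Tree

variable {ι V : Type} [Fintype ι] [DecidableEq ι] [Fintype V] [DecidableEq V]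

/-- The edges `j ∈ J`, each joining two different vertices `fst j` and `snd j`, form a spanning tree
of `V`. The vectors `face v` are the rows of the incidence matrix, over `ℤ/2`, of the graph with all
edges. That `J` has no cycles is expressed by the incidence matrix being injective on the vectors
supported on `J`. -/
structure IsSpanningTree (face : V → ι → ZMod 2) (fst snd : ι → V) (J : Finset ι) : Prop where
  face_apply : ∀ v j, face v j = Pi.single (M := fun _ => ZMod 2) (fst j) 1 v +
    Pi.single (M := fun _ => ZMod 2) (snd j) 1 v
  fst_ne_snd : ∀ j, fst j ≠ snd j
  connected : ∀ A : V → ZMod 2, (∀ j ∈ J, A (fst j) = A (snd j)) → ∀ u v, A u = A v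
  acyclic : ∀ η : ι → ZMod 2, (∀ j, j ∉ J → η j = 0) → (∀ v, face v ⬝ᵥ η = 0) → η = 0

/-- The number of elements of the set with indicator function `A`, times that of its complement. -/
def cutSize (A : V → ZMod 2) : ℝ :=
  (∑ v, ((A v).val : ℝ)) * (Fintype.card V - ∑ v, ((A v).val : ℝ))

lemma sum_val_nonneg (A : V → ZMod 2) : 0 ≤ ∑ v, ((A v).val : ℝ) :=
  Finset.sum_nonneg fun _ _ => Nat.cast_nonneg _

lemma val_le_one (x : ZMod 2) : (x.val : ℝ) ≤ 1 := by
  obtain rfl | rfl := zmod_two_cases x <;> simp [ZMod.val_one]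

lemma sum_val_le_card (A : V → ZMod 2) : ∑ v, ((A v).val : ℝ) ≤ Fintype.card V := by
  calc _ ≤ ∑ _v : V, (1 : ℝ) := Finset.sum_le_sum fun v _ => val_le_one (A v)
    _ = _ := by simp

lemma sum_val_add_single (A : V → ZMod 2) (p : V) :
    ∑ v, (((A + Pi.single p 1 : V → ZMod 2) v).val : ℝ) =
      ∑ v, ((A v).val : ℝ) + (if A p = 0 then 1 else -1) := by
  rw [← sub_eq_iff_eq_add', ← Finset.sum_sub_distrib, Finset.sum_eq_single p]
  · obtain hp | hp := zmod_two_cases (A p)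
    · simp [hp, ZMod.val_one]
    · simp [hp, show (1 + 1 : ZMod 2) = 0 from rfl, ZMod.val_one]
  · intro v _ hv
    simp [hv]
  · simp

lemma cutSize_nonneg (A : V → ZMod 2) : 0 ≤ cutSize A :=
  mul_nonneg (sum_val_nonneg A) (sub_nonneg.mpr (sum_val_le_card A))

lemma cutSize_le (A : V → ZMod 2) : cutSize A ≤ (Fintype.card V : ℝ) ^ 2 := by
  have h₁ := sum_val_nonneg A
  have h₂ := sum_val_le_card A
  rw [cutSize, sq]
  exact mul_le_mul h₂ (by linarith) (by linarith) (by positivity)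

lemma exists_apply_of_not_const {A : V → ZMod 2} (hA : ¬∀ u v, A u = A v) :
    (∃ u, A u = 0) ∧ ∃ v, A v = 1 := by
  push Not at hA
  obtain ⟨u, v, huv⟩ := hA
  obtain hu | hu := zmod_two_cases (A u) <;> obtain hv | hv := zmod_two_cases (A v)
  · exact absurd (hu.trans hv.symm) huv
  · exact ⟨⟨u, hu⟩, v, hv⟩
  · exact ⟨⟨v, hv⟩, u, hu⟩
  · exact absurd (hu.trans hv.symm) huv

lemma cutSize_eq_zero_iff (A : V → ZMod 2) : cutSize A = 0 ↔ ∀ u v, A u = A v := by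
  constructor
  · intro h
    by_contra hA
    obtain ⟨⟨u, hu⟩, v, hv⟩ := exists_apply_of_not_const hA
    refine (mul_pos ?_ (sub_pos.mpr ?_)).ne' h
    · exact Finset.sum_pos' (fun _ _ => Nat.cast_nonneg _)
        ⟨v, Finset.mem_univ _, by simp [hv, ZMod.val_one]⟩
    · calc _ < ∑ _v : V, (1 : ℝ) := Finset.sum_lt_sum (fun v _ => val_le_one (A v))
            ⟨u, Finset.mem_univ _, by simp [hu]⟩
        _ = _ := by simp
  · intro h
    rcases isEmpty_or_nonempty V with hV | ⟨⟨v⟩⟩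
    · simp [cutSize]
    · simp only [cutSize, fun u => h u v]
      obtain hv | hv := zmod_two_cases (A v)
      · simp [hv]
      · simp [hv, ZMod.val_one]

/-- The size is a martingale of the voter model, so that the product of the sizes of a set and its
complement has drift `2` per boundary edge. -/
lemma two_le_edgeDrift_cutSize {δ : ℝ} (hδ : δ ≤ 1) {p q : V} {A : V → ZMod 2}
    (hA : A p ≠ A q) : 2 ≤ edgeDrift δ 0 p q cutSize A := by
  have h₁ := cutSize_nonneg (A + Pi.single p 1)
  have h₂ := cutSize_nonneg (A + Pi.single q 1)
  have h₃ : 2 * cutSize A - (cutSize (A + Pi.single p 1) + cutSize (A + Pi.single q 1)) = 2 := by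
    simp only [cutSize, sum_val_add_single]
    obtain hp | hp := zmod_two_cases (A p) <;> obtain hq | hq := zmod_two_cases (A q)
    · exact absurd (hp.trans hq.symm) hA
    · simp only [hp, hq, if_true, one_ne_zero, if_false]
      ring
    · simp only [hp, hq, if_true, one_ne_zero, if_false]
      ring
    · exact absurd (hp.trans hq.symm) hA
  simp only [edgeDrift, Pi.zero_apply, if_true, if_neg hA]
  nlinarith

/-- The weight of the sector in which all stabilizers of the graph anticommute with the operators:
the constant functions are not damped directly, and get a larger weight. -/
def constWeight (A : V → ZMod 2) : ℝ := if ∀ u v, A u = A v then 3 / 2 else 1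

lemma one_le_constWeight (A : V → ZMod 2) : 1 ≤ constWeight A := by
  unfold constWeight
  split_ifs <;> norm_num

lemma constWeight_le (A : V → ZMod 2) : constWeight A ≤ 3 / 2 := by
  unfold constWeight
  split_ifs <;> norm_num

/-- The indicator function of the non-constant functions. -/
def nonconst (A : V → ZMod 2) : ℝ := if ∀ u v, A u = A v then 0 else 1

lemma nonconst_nonneg (A : V → ZMod 2) : 0 ≤ nonconst A := by
  unfold nonconst
  split_ifs <;> norm_num

lemma nonconst_le_one (A : V → ZMod 2) : nonconst A ≤ 1 := by
  unfold nonconst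
  split_ifs <;> norm_num

lemma nonconst_eq_zero_iff (A : V → ZMod 2) : nonconst A = 0 ↔ ∀ u v, A u = A v := by
  unfold nonconst
  split_ifs with h
  · exact iff_of_true rfl h
  · exact iff_of_false one_ne_zero h

namespace IsSpanningTree

variable {face : V → ι → ZMod 2} {fst snd : ι → V} {J : Finset ι} {δ : ℝ}

lemma exists_edge_ne (h : IsSpanningTree face fst snd J) {A : V → ZMod 2}
    (hA : ¬∀ u v, A u = A v) : ∃ j ∈ J, A (fst j) ≠ A (snd j) := by
  by_contra hJ
  push Not at hJ
  exact hA (h.connected A hJ)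

lemma half_le_sum_drift_one (h : IsSpanningTree face fst snd J) (hδ₀ : 0 ≤ δ) (hδ₁ : δ ≤ 1)
    {a : V → ZMod 2} (ha : ¬∀ u v, a u = a v) (A : V → ZMod 2) :
    1 / 2 ≤ ∑ j ∈ J, edgeDrift δ a (fst j) (snd j) (fun _ => 1) A := by
  obtain ⟨j, hj, hne⟩ := h.exists_edge_ne ha
  exact (half_le_edgeDrift_one hδ₁ hne A).trans
    (Finset.single_le_sum (f := fun j => edgeDrift δ a (fst j) (snd j) (fun _ => 1) A)
      (fun j _ => edgeDrift_const_nonneg hδ₀ hδ₁ a _ _ zero_le_one A) hj)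

lemma le_sum_drift_nonconst (h : IsSpanningTree face fst snd J) (hδ₀ : 0 ≤ δ) (hδ₁ : δ ≤ 1)
    (A : V → ZMod 2) :
    2 * (1 - δ) * nonconst A ≤ ∑ j ∈ J, edgeDrift δ 0 (fst j) (snd j) nonconst A := by
  have hnn : ∀ j ∈ J, 0 ≤ edgeDrift δ 0 (fst j) (snd j) nonconst A := by
    intro j _
    simp only [edgeDrift, Pi.zero_apply, if_true]
    split_ifs with hA
    · exact le_rfl
    · have hA' : nonconst A = 1 := if_neg fun hc => hA (hc _ _)
      have h₁ := mul_le_mul_of_nonneg_left (nonconst_le_one (A + Pi.single (fst j) 1)) hδ₀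
      have h₂ := mul_le_mul_of_nonneg_left (nonconst_le_one (A + Pi.single (snd j) 1)) hδ₀
      linarith
  by_cases hA : ∀ u v, A u = A v
  · rw [(nonconst_eq_zero_iff A).mpr hA, mul_zero]
    exact Finset.sum_nonneg hnn
  · obtain ⟨j, hj, hne⟩ := h.exists_edge_ne hA
    refine le_trans ?_ (Finset.single_le_sum hnn hj)
    have hA' : nonconst A = 1 := if_neg hA
    have h₁ := mul_le_mul_of_nonneg_left (nonconst_le_one (A + Pi.single (fst j) 1)) hδ₀
    have h₂ := mul_le_mul_of_nonneg_left (nonconst_le_one (A + Pi.single (snd j) 1)) hδ₀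
    simp only [edgeDrift, Pi.zero_apply, if_true, if_neg hne, hA']
    linarith

lemma le_sum_drift_cutSize (h : IsSpanningTree face fst snd J) (hδ₁ : δ ≤ 1)
    (A : V → ZMod 2) :
    2 / (Fintype.card V : ℝ) ^ 2 * cutSize A ≤
      ∑ j ∈ J, edgeDrift δ 0 (fst j) (snd j) cutSize A := by
  have hnn : ∀ j ∈ J, 0 ≤ edgeDrift δ 0 (fst j) (snd j) cutSize A := by
    intro j _
    by_cases hA : A (fst j) = A (snd j)
    · simp [edgeDrift, hA]
    · exact zero_le_two.trans (two_le_edgeDrift_cutSize hδ₁ hA)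
  by_cases hA : ∀ u v, A u = A v
  · rw [(cutSize_eq_zero_iff A).mpr hA, mul_zero]
    exact Finset.sum_nonneg hnn
  · obtain ⟨j, hj, hne⟩ := h.exists_edge_ne hA
    refine le_trans ?_ (Finset.single_le_sum hnn hj)
    refine le_trans ?_ (two_le_edgeDrift_cutSize hδ₁ hne)
    rw [div_mul_eq_mul_div]
    exact div_le_of_le_mul₀ (by positivity) zero_le_two
      (mul_le_mul_of_nonneg_left (cutSize_le A) zero_le_two)

lemma edge_ext (h : IsSpanningTree face fst snd J) {i j : ι} (hi : i ∈ J) (hj : j ∈ J)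
    (hij : (Pi.single (snd i) 1 + Pi.single (fst i) 1 : V → ZMod 2) =
      Pi.single (snd j) 1 + Pi.single (fst j) 1) : i = j := by
  have hη : (Pi.single i 1 + Pi.single j 1 : ι → ZMod 2) = 0 := by
    refine h.acyclic _ (fun k hk => ?_) fun v => ?_
    · rw [Pi.add_apply, Pi.single_eq_of_ne (by rintro rfl; exact hk hi),
        Pi.single_eq_of_ne (by rintro rfl; exact hk hj), add_zero]
    · have hv := congrFun hij v
      simp only [Pi.add_apply] at hv
      rw [dotProduct_add, dotProduct_single_one, dotProduct_single_one, h.face_apply,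
        h.face_apply, add_comm, add_comm (Pi.single (fst i) _ v), hv,
        add_comm (Pi.single (fst j) _ v)]
      exact CharTwo.add_self_eq_zero _
  by_contra hne
  have := congrFun hη i
  simp [Pi.single_eq_of_ne hne] at this

lemma le_sum_drift_constWeight (h : IsSpanningTree face fst snd J)
    (hV : 3 ≤ Fintype.card V) {a : V → ZMod 2} (ha : ∀ v, a v = 1) (A : V → ZMod 2) :
    1 / 6 * constWeight A ≤ ∑ j ∈ J, edgeDrift δ a (fst j) (snd j) constWeight A := by
  by_cases hA : ∀ u v, A u = A v
  · have hJ : J.Nonempty := by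
      rw [Finset.nonempty_iff_ne_empty]
      rintro rfl
      obtain ⟨u, v, huv⟩ := Fintype.exists_pair_of_one_lt_card (α := V) (by omega)
      have := h.connected (Pi.single u 1) (by simp) u v
      simp [Pi.single_eq_of_ne (Ne.symm huv)] at this
    obtain ⟨j₀, hj₀⟩ := hJ
    have hone : ∀ j, edgeDrift δ a (fst j) (snd j) constWeight A = 1 / 4 := by
      intro j
      have hA' : constWeight A = 3 / 2 := if_pos hA
      -- a third vertex shows that flipping both end points of an edge destroys constancy
      have hne : ¬∀ u v, (A + Pi.single (snd j) 1 + Pi.single (fst j) 1 : V → ZMod 2) u =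
          (A + Pi.single (snd j) 1 + Pi.single (fst j) 1 : V → ZMod 2) v := by
        obtain ⟨w, -, hw⟩ := Finset.exists_mem_notMem_of_card_lt_card
          (s := {fst j, snd j}) (t := (Finset.univ : Finset V))
          (Finset.card_le_two.trans_lt (by rw [Finset.card_univ]; omega))
        simp only [Finset.mem_insert, Finset.mem_singleton, not_or] at hw
        intro hc
        have := hc (fst j) w
        simp [Pi.single_eq_of_ne hw.1, Pi.single_eq_of_ne hw.2,
          Pi.single_eq_of_ne (h.fst_ne_snd j), hA (fst j) w] at this
      have hA'' : constWeight (A + Pi.single (snd j) 1 + Pi.single (fst j) 1) = 1 := if_neg hne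
      simp only [edgeDrift, ha, one_ne_zero, if_false, if_pos (hA (fst j) (snd j)), hA', hA'']
      norm_num
    rw [Finset.sum_congr rfl fun j _ => hone j, Finset.sum_const, nsmul_eq_mul]
    have : (1 : ℝ) ≤ J.card := by exact_mod_cast Finset.card_pos.mpr ⟨j₀, hj₀⟩
    linarith [constWeight_le A]
  · have hA' : constWeight A = 1 := if_neg hA
    obtain ⟨j₀, hj₀, hne⟩ := h.exists_edge_ne hA
    let E : Finset ι := J.filter fun j => ∀ u v,
      (A + Pi.single (snd j) 1 + Pi.single (fst j) 1 : V → ZMod 2) u =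
        (A + Pi.single (snd j) 1 + Pi.single (fst j) 1 : V → ZMod 2) v
    -- at most one edge leads to each of the two constant functions
    have hE : E.card ≤ 2 := by
      have : E.card ≤ (Finset.univ : Finset (ZMod 2)).card := by
        refine Finset.card_le_card_of_injOn
          (fun j => (A + Pi.single (snd j) 1 + Pi.single (fst j) 1 : V → ZMod 2) (fst j₀))
          (fun _ _ => Finset.mem_univ _) ?_
        intro i hi j hj hij
        obtain ⟨hiJ, hi⟩ := Finset.mem_filter.mp hi
        obtain ⟨hjJ, hj⟩ := Finset.mem_filter.mp hj
        refine h.edge_ext hiJ hjJ (add_left_cancel (a := A) ?_)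
        rw [← add_assoc, ← add_assoc]
        exact funext fun v => (hi v (fst j₀)).trans (hij.trans (hj (fst j₀) v))
      simpa using this
    have hlow : ∀ j ∈ J, (if j = j₀ then 3 / 4 else 0) +
        (if j ∈ E then -1 / 4 else (0 : ℝ)) ≤ edgeDrift δ a (fst j) (snd j) constWeight A := by
      intro j hj
      simp only [edgeDrift, ha, one_ne_zero, if_false, hA']
      have h₁ := constWeight_le (A + Pi.single (snd j) 1 + Pi.single (fst j) 1)
      by_cases hjA : A (fst j) = A (snd j)
      · have hjj : j ≠ j₀ := fun e => hne (e ▸ hjA)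
        rw [if_neg hjj, if_pos hjA]
        split_ifs with hjE
        · linarith
        · have : constWeight (A + Pi.single (snd j) 1 + Pi.single (fst j) 1) = 1 :=
            if_neg fun hc => hjE (Finset.mem_filter.mpr ⟨hj, hc⟩)
          rw [this]
          norm_num
      · rw [if_neg hjA]
        split_ifs <;> linarith
    refine le_trans ?_ (Finset.sum_le_sum hlow)
    rw [Finset.sum_add_distrib, Finset.sum_ite_eq', if_pos hj₀, ← Finset.sum_filter,
      Finset.sum_const, nsmul_eq_mul, hA']
    have : ((J.filter fun j => j ∈ E).card : ℝ) ≤ 2 := by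
      exact_mod_cast (Finset.card_le_card fun j hj => (Finset.mem_filter.mp hj).2).trans hE
    linarith

end IsSpanningTree

/-- The lower bound for the eigenvalues of the sum of the edge operators of two spanning trees, in
the sector `(a, a')` of operators that anticommute with the stabilizers `v` with `a v = 1` and
`a' v = 1`. In the sector `(0, 0)`, the pairs of constant functions stand for the identity. -/
lemma le_re_of_trees {δ : ℝ} (hδ₀ : 0 ≤ δ) (hδ₁ : δ ≤ 1) (hV : 3 ≤ Fintype.card V)
    {face face' : V → ι → ZMod 2} {fst snd fst' snd' : ι → V} {J J' : Finset ι}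
    (hT : IsSpanningTree face fst snd J) (hT' : IsSpanningTree face' fst' snd' J')
    {a a' : V → ZMod 2} {z : ℂ} {g : (V → ZMod 2) → (V → ZMod 2) → ℂ}
    (hg : ∀ A B, z * g A B = ∑ j ∈ J, edgeOp δ a (fst j) (snd j) (fun A => g A B) A +
      ∑ j ∈ J', edgeOp δ a' (fst' j) (snd' j) (g A) B)
    (hg₀ : ∃ A B, g A B ≠ 0)
    (hconst : a = 0 → a' = 0 → ∀ A B, (∀ u v, A u = A v) → (∀ u v, B u = B v) → g A B = 0) :
    min (1 / 6) (max (2 * (1 - δ)) (2 / (Fintype.card V : ℝ) ^ 2)) ≤ z.re := by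
  have hV₀ : Nonempty V := Fintype.card_pos_iff.mp (by omega)
  have hnn : ∀ (b : V → ZMod 2) (f s : ι → V) (I : Finset ι) {k : ℝ} (_ : 0 ≤ k) (A : V → ZMod 2),
      0 ≤ ∑ j ∈ I, edgeDrift δ b (f j) (s j) (fun _ => k) A := fun b f s I k hk A =>
    Finset.sum_nonneg fun j _ => edgeDrift_const_nonneg hδ₀ hδ₁ b _ _ hk A
  have hcases : ∀ b : V → ZMod 2, (¬∀ u v, b u = b v) ∨ (∀ v, b v = 1) ∨ b = 0 := by
    intro b
    by_cases hb : ∀ u v, b u = b v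
    · obtain ⟨w⟩ := hV₀
      obtain hw | hw := zmod_two_cases (b w)
      · exact Or.inr (Or.inr (funext fun v => (hb v w).trans hw))
      · exact Or.inr (Or.inl fun v => (hb v w).trans hw)
    · exact Or.inl hb
  rcases hcases a with ha | ha | ha
  · refine min_le_of_left_le (le_trans (by norm_num : (1 : ℝ) / 6 ≤ 1 / 2) ?_)
    refine le_re_of_edgeDrift hδ₀ hg hg₀ (h := fun _ _ => 1) (by simp) (by simp) fun A B => ?_
    linarith [hT.half_le_sum_drift_one hδ₀ hδ₁ ha A, hnn a' fst' snd' J' zero_le_one B]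
  · refine min_le_of_left_le ?_
    refine le_re_of_edgeDrift hδ₀ hg hg₀ (h := fun A _ => constWeight A)
      (fun A _ => zero_le_one.trans (one_le_constWeight A))
      (fun A _ h0 => absurd h0 (zero_lt_one.trans_le (one_le_constWeight A)).ne') fun A B => ?_
    linarith [hT.le_sum_drift_constWeight (δ := δ) hV ha A,
      hnn a' fst' snd' J' (zero_le_one.trans (one_le_constWeight A)) B]
  rcases hcases a' with ha' | ha' | ha'
  · refine min_le_of_left_le (le_trans (by norm_num : (1 : ℝ) / 6 ≤ 1 / 2) ?_)
    refine le_re_of_edgeDrift hδ₀ hg hg₀ (h := fun _ _ => 1) (by simp) (by simp) fun A B => ?_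
    linarith [hT'.half_le_sum_drift_one hδ₀ hδ₁ ha' B, hnn a fst snd J zero_le_one A]
  · refine min_le_of_left_le ?_
    refine le_re_of_edgeDrift hδ₀ hg hg₀ (h := fun _ B => constWeight B)
      (fun _ B => zero_le_one.trans (one_le_constWeight B))
      (fun _ B h0 => absurd h0 (zero_lt_one.trans_le (one_le_constWeight B)).ne') fun A B => ?_
    linarith [hT'.le_sum_drift_constWeight (δ := δ) hV ha' B,
      hnn a fst snd J (zero_le_one.trans (one_le_constWeight B)) A]
  subst ha ha'
  have hmain : ∀ {w : (V → ZMod 2) → ℝ} {c : ℝ}, (∀ A, 0 ≤ w A) →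
      (∀ A, w A = 0 → ∀ u v, A u = A v) →
      (∀ A, c * w A ≤ ∑ j ∈ J, edgeDrift δ 0 (fst j) (snd j) w A) →
      (∀ A, c * w A ≤ ∑ j ∈ J', edgeDrift δ 0 (fst' j) (snd' j) w A) → c ≤ z.re := by
    intro w c hw hw₀ hc hc'
    refine le_re_of_edgeDrift hδ₀ hg hg₀ (h := fun A B => w A + w B)
      (fun A B => add_nonneg (hw A) (hw B)) (fun A B h0 => ?_) fun A B => ?_
    · have h₁ := hw A
      have h₂ := hw B
      exact hconst rfl rfl A B (hw₀ A (by linarith)) (hw₀ B (by linarith))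
    · have e₁ := hnn 0 fst snd J (hw B) A
      have e₂ := hnn 0 fst' snd' J' (hw A) B
      have hcomm : (fun B => w A + w B) = fun B => w B + w A := funext fun B => add_comm _ _
      simp only [hcomm, edgeDrift_add_const, Finset.sum_add_distrib]
      linarith [hc A, hc' B]
  refine min_le_of_right_le (max_le ?_ ?_)
  · exact hmain nonconst_nonneg (fun A => (nonconst_eq_zero_iff A).mp)
      (hT.le_sum_drift_nonconst hδ₀ hδ₁) (hT'.le_sum_drift_nonconst hδ₀ hδ₁)
  · exact hmain cutSize_nonneg (fun A => (cutSize_eq_zero_iff A).mp)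
      (hT.le_sum_drift_cutSize hδ₁) (hT'.le_sum_drift_cutSize hδ₁)

end Tree

/-! ### Tensor factors -/

section TensorFactors

variable {n a b : Type} [Fintype n] [DecidableEq n] [Fintype a] [DecidableEq a] [Fintype b]
  [DecidableEq b]

/-- The embedding of the operators of the first tensor factor, for a factorization `e` of the set of
basis labels. -/
def leftEmb (e : n ≃ a × b) : Matrix a a ℂ →ₐ[ℂ] Matrix n n ℂ :=
  AlgHom.ofLinearMap
    { toFun := fun A => (A ⊗ₖ (1 : Matrix b b ℂ)).submatrix e e
      map_add' := fun A B => by rw [Matrix.add_kronecker]; rfl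
      map_smul' := fun c A => by rw [Matrix.smul_kronecker]; rfl }
    (by simp)
    (fun A B => by simp [Matrix.submatrix_mul_equiv, ← Matrix.mul_kronecker_mul])

/-- The embedding of the operators of the second tensor factor. -/
def rightEmb (e : n ≃ a × b) : Matrix b b ℂ →ₐ[ℂ] Matrix n n ℂ :=
  AlgHom.ofLinearMap
    { toFun := fun B => ((1 : Matrix a a ℂ) ⊗ₖ B).submatrix e e
      map_add' := fun A B => by rw [Matrix.kronecker_add]; rfl
      map_smul' := fun c A => by rw [Matrix.kronecker_smul]; rfl }
    (by simp)
    (fun A B => by simp [Matrix.submatrix_mul_equiv, ← Matrix.mul_kronecker_mul])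

lemma leftEmb_apply (e : n ≃ a × b) (A : Matrix a a ℂ) :
    leftEmb e A = (A ⊗ₖ (1 : Matrix b b ℂ)).submatrix e e := rfl

lemma rightEmb_apply (e : n ≃ a × b) (B : Matrix b b ℂ) :
    rightEmb e B = ((1 : Matrix a a ℂ) ⊗ₖ B).submatrix e e := rfl

lemma leftEmb_mul_rightEmb (e : n ≃ a × b) (A : Matrix a a ℂ) (B : Matrix b b ℂ) :
    leftEmb e A * rightEmb e B = (A ⊗ₖ B).submatrix e e := by
  rw [leftEmb_apply, rightEmb_apply, Matrix.submatrix_mul_equiv, ← Matrix.mul_kronecker_mul,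
    mul_one, one_mul]

lemma leftEmb_commute_rightEmb (e : n ≃ a × b) (A : Matrix a a ℂ) (B : Matrix b b ℂ) :
    Commute (leftEmb e A) (rightEmb e B) := by
  rw [commute_iff_eq, leftEmb_mul_rightEmb, leftEmb_apply, rightEmb_apply,
    Matrix.submatrix_mul_equiv, ← Matrix.mul_kronecker_mul, mul_one, one_mul]

lemma rightEmb_injective [Nonempty a] (e : n ≃ a × b) : Function.Injective (rightEmb e) := by
  intro B B' h
  obtain ⟨i⟩ := ‹Nonempty a›
  ext s t
  have := congrFun (congrFun h (e.symm (i, s))) (e.symm (i, t))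
  simpa [rightEmb_apply] using this

variable {a' b' : Type} [Fintype a'] [DecidableEq a'] [Fintype b'] [DecidableEq b']

lemma range_leftEmb_prodCongr (e : n ≃ a × b) (f : a ≃ a') (k : b ≃ b') :
    (leftEmb (e.trans (f.prodCongr k))).range = (leftEmb e).range := by
  have h : ∀ A, leftEmb (e.trans (f.prodCongr k)) A = leftEmb e (A.submatrix f f) := fun A => by
    ext s t
    simp [leftEmb_apply, Matrix.one_apply]
  ext M
  constructor
  · rintro ⟨A, rfl⟩
    exact ⟨A.submatrix f f, (h A).symm⟩
  · rintro ⟨A, rfl⟩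
    exact ⟨A.submatrix f.symm f.symm, by simpa using h (A.submatrix f.symm f.symm)⟩

lemma range_rightEmb_prodCongr (e : n ≃ a × b) (f : a ≃ a') (k : b ≃ b') :
    (rightEmb (e.trans (f.prodCongr k))).range = (rightEmb e).range := by
  have h : ∀ A, rightEmb (e.trans (f.prodCongr k)) A = rightEmb e (A.submatrix k k) := fun A => by
    ext s t
    simp [rightEmb_apply, Matrix.one_apply]
  ext M
  constructor
  · rintro ⟨A, rfl⟩
    exact ⟨A.submatrix k k, (h A).symm⟩
  · rintro ⟨A, rfl⟩
    exact ⟨A.submatrix k.symm k.symm, by simpa using h (A.submatrix k.symm k.symm)⟩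

/-- The permutation matrix of a factorization of the set of basis labels. -/
def factorUnitary (e : n ≃ a × b) : Matrix (a × b) n ℂ :=
  (1 : Matrix (a × b) (a × b) ℂ).submatrix id e

lemma factorUnitary_mul_conjTranspose (e : n ≃ a × b) :
    factorUnitary e * (factorUnitary e)ᴴ = 1 := by
  simp [factorUnitary, Matrix.submatrix_mul_equiv]

lemma conjTranspose_mul_factorUnitary (e : n ≃ a × b) :
    (factorUnitary e)ᴴ * factorUnitary e = 1 := by
  rw [factorUnitary, Matrix.conjTranspose_submatrix, Matrix.conjTranspose_one,
    ← Matrix.submatrix_mul _ _ _ _ _ Function.bijective_id, one_mul, Matrix.submatrix_one_equiv]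

lemma factorUnitary_conj (e : n ≃ a × b) (M : Matrix (a × b) (a × b) ℂ) :
    (factorUnitary e)ᴴ * M * factorUnitary e = M.submatrix e e := by
  nth_rewrite 1 [← Matrix.submatrix_id_id M]
  rw [factorUnitary, Matrix.conjTranspose_submatrix, Matrix.conjTranspose_one,
    ← Matrix.submatrix_mul _ _ _ _ _ Function.bijective_id,
    ← Matrix.submatrix_mul _ _ _ _ _ Function.bijective_id, one_mul, mul_one]

end TensorFactors

section FullAlgebra

variable {G : Type} [Fintype G] [DecidableEq G] [AddCommGroup G]

/-- The translation by `g`, as an operator on the functions on a finite group. -/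
def translation (g : G) : Matrix G G ℂ := Matrix.of fun s t => if s = t + g then 1 else 0

/-- An algebra that contains all translations and enough diagonal matrices to separate the points
is the full matrix algebra. -/
lemma eq_top_of_translation_of_diagonal {𝒜 : Subalgebra ℂ (Matrix G G ℂ)}
    (hT : ∀ g, translation g ∈ 𝒜)
    (hD : ∀ s t : G, s ≠ t → ∃ f : G → ℂ, Matrix.diagonal f ∈ 𝒜 ∧ f s ≠ f t) : 𝒜 = ⊤ := by
  let 𝒟 : Subalgebra ℂ (G → ℂ) := 𝒜.comap (Matrix.diagonalAlgHom ℂ)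
  have hsingle : ∀ s : G, (Pi.single s 1 : G → ℂ) ∈ 𝒟 := by
    intro s
    have h : ∀ t, ∃ f ∈ 𝒟, t ≠ s → f s = 1 ∧ f t = 0 := by
      intro t
      by_cases hst : s = t
      · exact ⟨0, zero_mem _, fun h => absurd hst.symm h⟩
      · obtain ⟨f, hf, hne⟩ := hD s t hst
        have hf' : f ∈ 𝒟 := hf
        refine ⟨(f s - f t)⁻¹ • (f - algebraMap ℂ _ (f t)),
          𝒟.smul_mem (sub_mem hf' (𝒟.algebraMap_mem _)) _, fun _ => ?_⟩
        simp [inv_mul_cancel₀ (sub_ne_zero.mpr hne)]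
    choose f hf hft using h
    have hprod : (Pi.single s 1 : G → ℂ) = ∏ t ∈ Finset.univ.erase s, f t := by
      ext t
      rw [Finset.prod_apply]
      by_cases ht : t = s
      · subst ht
        rw [Pi.single_eq_same, Finset.prod_eq_one]
        exact fun u hu => (hft u (Finset.ne_of_mem_erase hu)).1
      · rw [Pi.single_eq_of_ne ht]
        exact (Finset.prod_eq_zero (f := fun u => f u t)
          (Finset.mem_erase.mpr ⟨ht, Finset.mem_univ t⟩) (hft t ht).2).symm
    rw [hprod]
    exact prod_mem fun t _ => hf t
  refine eq_top_iff.mpr fun M _ => ?_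
  rw [Matrix.matrix_eq_sum_single M]
  refine sum_mem fun s _ => sum_mem fun t _ => ?_
  have hst : Matrix.single s t (M s t) =
      M s t • (translation (s - t) * Matrix.diagonal (Pi.single t 1)) := by
    ext u v
    simp only [Matrix.smul_apply, Matrix.mul_diagonal, translation, Matrix.of_apply,
      Matrix.single_apply, Pi.single_apply, smul_eq_mul]
    by_cases hv : v = t
    · subst hv
      simp [eq_comm (a := s)]
    · simp [hv, Ne.symm hv]
  rw [hst]
  exact 𝒜.smul_mem (mul_mem (hT _) (hsingle t)) _

end FullAlgebra

/-! ### Logical and syndrome factors of a Pauli algebra -/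

section LogicalFactor

variable {ι : Type} [Fintype ι] [DecidableEq ι]

lemma zmod_two_smul_cases {M : Type} [AddCommGroup M] [Module (ZMod 2) M] (c : ZMod 2) (m : M) :
    c • m = 0 ∨ c • m = m := by
  obtain rfl | rfl := zmod_two_cases c
  · exact Or.inl (zero_smul _ _)
  · exact Or.inr (one_smul _ _)

/-- The vectors `τ` for which the product of the `σ^x` over `τ` belongs to an algebra. -/
def shifts (𝒜 : Subalgebra ℂ (Matrix (ι → ZMod 2) (ι → ZMod 2) ℂ)) :
    Submodule (ZMod 2) (ι → ZMod 2) where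
  carrier := {τ | pauli τ 0 ∈ 𝒜}
  zero_mem' := by
    rw [Set.mem_ofPred_eq, pauli_zero_zero]
    exact one_mem 𝒜
  add_mem' {τ τ'} h h' := by
    rw [Set.mem_ofPred_eq, pauli_add_left]
    exact mul_mem h h'
  smul_mem' c τ h := by
    rcases zmod_two_smul_cases c τ with hc | hc
    · rw [hc, Set.mem_ofPred_eq, pauli_zero_zero]
      exact one_mem 𝒜
    · rwa [hc]

lemma mem_shifts {𝒜 : Subalgebra ℂ (Matrix (ι → ZMod 2) (ι → ZMod 2) ℂ)} {τ : ι → ZMod 2} :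
    τ ∈ shifts 𝒜 ↔ pauli τ 0 ∈ 𝒜 := Iff.rfl

variable {x z : Fin 2 → ι → ZMod 2}

/-- The configurations on which both logical `Z` have the value `1`. -/
def logicKer (z : Fin 2 → ι → ZMod 2) : Submodule (ZMod 2) (ι → ZMod 2) where
  carrier := {s | ∀ i, z i ⬝ᵥ s = 0}
  zero_mem' := by simp
  add_mem' h h' i := by rw [dotProduct_add, h i, h' i, add_zero]
  smul_mem' c s h i := by rw [dotProduct_smul, h i, smul_zero]

instance : DecidablePred (· ∈ logicKer z) := fun s =>
  inferInstanceAs (Decidable (∀ i, z i ⬝ᵥ s = 0))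

lemma dotProduct_sum_smul (hzx : ∀ i j, z i ⬝ᵥ x j = if i = j then 1 else 0)
    (l : Fin 2 → ZMod 2) (i : Fin 2) : z i ⬝ᵥ ∑ j, l j • x j = l i := by
  simp only [dotProduct_sum, dotProduct_smul, hzx, smul_eq_mul, mul_ite, mul_one, mul_zero,
    Finset.sum_ite_eq, Finset.mem_univ, if_true]

/-- The factorization of the basis labels: the values of the two logical `Z`, and the configuration
from which these values have been removed by means of the dual vectors `x`. -/
def logicEquiv (hzx : ∀ i j, z i ⬝ᵥ x j = if i = j then 1 else 0) :
    (ι → ZMod 2) ≃ (Fin 2 → ZMod 2) × logicKer z where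
  toFun s := (fun i => z i ⬝ᵥ s, ⟨s + ∑ i, (z i ⬝ᵥ s) • x i, fun i => by
    rw [dotProduct_add, dotProduct_sum_smul hzx fun i => z i ⬝ᵥ s]
    exact CharTwo.add_self_eq_zero _⟩)
  invFun y := y.2 + ∑ i, y.1 i • x i
  left_inv s := by
    simp only
    rw [add_assoc, add_self_zmod_two, add_zero]
  right_inv := by
    rintro ⟨l, k, hk⟩
    have h : ∀ i, z i ⬝ᵥ (k + ∑ i, l i • x i) = l i := fun i => by
      rw [dotProduct_add, hk i, zero_add, dotProduct_sum_smul hzx]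
    refine Prod.ext (funext h) (Subtype.ext ?_)
    simp only [h]
    rw [add_assoc, add_self_zmod_two, add_zero]

variable (hzx : ∀ i j, z i ⬝ᵥ x j = if i = j then 1 else 0)

lemma logicEquiv_add_left (s : ι → ZMod 2) (l : Fin 2 → ZMod 2) :
    logicEquiv hzx (s + ∑ i, l i • x i) =
      ((logicEquiv hzx s).1 + l, (logicEquiv hzx s).2) := by
  rw [← Equiv.eq_symm_apply]
  simp only [logicEquiv, Equiv.coe_fn_mk, Equiv.coe_fn_symm_mk, Pi.add_apply, add_smul,
    Finset.sum_add_distrib]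
  rw [← add_assoc, add_assoc s, add_self_zmod_two, add_zero]

lemma logicEquiv_add_right (s : ι → ZMod 2) (k : logicKer z) :
    logicEquiv hzx (s + k) = ((logicEquiv hzx s).1, (logicEquiv hzx s).2 + k) := by
  rw [← Equiv.eq_symm_apply]
  simp only [logicEquiv, Equiv.coe_fn_mk, Equiv.coe_fn_symm_mk, Submodule.coe_add]
  rw [add_assoc, add_assoc, add_comm (k : ι → ZMod 2), ← add_assoc _ _ (k : ι → ZMod 2),
    add_self_zmod_two, zero_add]

lemma leftEmb_translation (l : Fin 2 → ZMod 2) :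
    leftEmb (logicEquiv hzx) (translation l) = pauli (∑ i, l i • x i) 0 := by
  ext s t
  simp only [leftEmb_apply, Matrix.submatrix_apply, Matrix.kroneckerMap_apply, translation,
    Matrix.of_apply, Matrix.one_apply, pauli_apply, zero_dotProduct, sgn_zero]
  have hiff : s = t + ∑ i, l i • x i ↔ (logicEquiv hzx s).1 = (logicEquiv hzx t).1 + l ∧
      (logicEquiv hzx s).2 = (logicEquiv hzx t).2 := by
    rw [← (logicEquiv hzx).apply_eq_iff_eq, logicEquiv_add_left, Prod.ext_iff]
  simp only [hiff, ite_and]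
  split_ifs <;> simp

lemma leftEmb_diagonal (i : Fin 2) :
    leftEmb (logicEquiv hzx) (Matrix.diagonal fun l => sgn (l i)) = pauli 0 (z i) := by
  ext s t
  simp only [leftEmb_apply, Matrix.submatrix_apply, Matrix.kroneckerMap_apply, Matrix.diagonal_apply,
    Matrix.one_apply, pauli_apply, add_zero]
  have hiff : s = t ↔ (logicEquiv hzx s).1 = (logicEquiv hzx t).1 ∧
      (logicEquiv hzx s).2 = (logicEquiv hzx t).2 := by
    rw [← (logicEquiv hzx).apply_eq_iff_eq, Prod.ext_iff]
  simp only [hiff, ite_and]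
  split_ifs with h₁ h₂
  · rw [h₁]
    simp [logicEquiv]
  all_goals simp

lemma rightEmb_translation (k : logicKer z) :
    rightEmb (logicEquiv hzx) (translation k) = pauli k 0 := by
  ext s t
  simp only [rightEmb_apply, Matrix.submatrix_apply, Matrix.kroneckerMap_apply, translation,
    Matrix.of_apply, Matrix.one_apply, pauli_apply, zero_dotProduct, sgn_zero]
  have hiff : s = t + k ↔ (logicEquiv hzx s).1 = (logicEquiv hzx t).1 ∧
      (logicEquiv hzx s).2 = (logicEquiv hzx t).2 + k := by
    rw [← (logicEquiv hzx).apply_eq_iff_eq, logicEquiv_add_right, Prod.ext_iff]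
  simp only [hiff, ite_and]
  split_ifs <;> simp

lemma rightEmb_diagonal {χ : ι → ZMod 2} (hχ : ∀ i, χ ⬝ᵥ x i = 0) :
    rightEmb (logicEquiv hzx) (Matrix.diagonal fun k : logicKer z => sgn (χ ⬝ᵥ (k : ι → ZMod 2))) =
      pauli 0 χ := by
  have h : ∀ s, χ ⬝ᵥ ((logicEquiv hzx s).2 : ι → ZMod 2) = χ ⬝ᵥ s := fun s => by
    simp [logicEquiv, dotProduct_add, dotProduct_smul, hχ]
  ext s t
  simp only [rightEmb_apply, Matrix.submatrix_apply, Matrix.kroneckerMap_apply,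
    Matrix.diagonal_apply, Matrix.one_apply, pauli_apply, add_zero, h]
  have hiff : s = t ↔ (logicEquiv hzx s).1 = (logicEquiv hzx t).1 ∧
      (logicEquiv hzx s).2 = (logicEquiv hzx t).2 := by
    rw [← (logicEquiv hzx).apply_eq_iff_eq, Prod.ext_iff]
  simp only [hiff, ite_and]
  split_ifs with h₁ h₂
  · rw [← h s, h₂, h t, one_mul]
  all_goals simp

lemma pauli_mem_range_rightEmb {τ χ : ι → ZMod 2} (hτ : ∀ i, z i ⬝ᵥ τ = 0)
    (hχ : ∀ i, χ ⬝ᵥ x i = 0) : pauli τ χ ∈ (rightEmb (logicEquiv hzx)).range := by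
  rw [pauli_eq_mul]
  exact mul_mem ⟨translation ⟨τ, hτ⟩, rightEmb_translation hzx ⟨τ, hτ⟩⟩
    ⟨_, rightEmb_diagonal hzx hχ⟩

/-- The algebra of the logical operators is the first tensor factor. -/
lemma adjoin_logical_eq_range :
    Algebra.adjoin ℂ ((Set.range fun i => pauli (x i) 0) ∪ Set.range fun i => pauli 0 (z i)) =
      (leftEmb (logicEquiv hzx)).range := by
  apply le_antisymm
  · refine Algebra.adjoin_le (Set.union_subset ?_ ?_)
    · rintro _ ⟨i, rfl⟩
      refine ⟨translation (Pi.single i 1), (leftEmb_translation hzx _).trans ?_⟩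
      simp [Pi.single_apply, ite_smul]
    · rintro _ ⟨i, rfl⟩
      exact ⟨_, leftEmb_diagonal hzx i⟩
  · set 𝒜 := Algebra.adjoin ℂ ((Set.range fun i => pauli (x i) 0) ∪
      Set.range fun i => pauli 0 (z i))
    have htop : 𝒜.comap (leftEmb (logicEquiv hzx)) = ⊤ := by
      refine eq_top_of_translation_of_diagonal (fun l => ?_) fun s t hst => ?_
      · rw [Subalgebra.mem_comap, leftEmb_translation, ← mem_shifts]
        exact sum_mem fun i _ => Submodule.smul_mem _ _
          (mem_shifts.mpr (Algebra.subset_adjoin (Or.inl ⟨i, rfl⟩)))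
      · obtain ⟨i, hi⟩ := Function.ne_iff.mp hst
        refine ⟨fun l => sgn (l i), ?_, sgn_injective.ne hi⟩
        rw [Subalgebra.mem_comap, leftEmb_diagonal]
        exact Algebra.subset_adjoin (Or.inr ⟨i, rfl⟩)
    rintro _ ⟨A, rfl⟩
    exact (htop ▸ Algebra.mem_top : A ∈ 𝒜.comap (leftEmb (logicEquiv hzx)))

/-- An algebra generated by products of `σ^x` and products of `σ^z` is the second tensor factor, if
the generators commute with the logical operators and if no other product of `σ^x`, or of `σ^z`,
commutes with all of the logical operators and generators of the other kind. -/
lemma adjoin_syndrome_eq_range {SX SZ : Set (ι → ZMod 2)} (hSX : ∀ τ ∈ SX, ∀ i, z i ⬝ᵥ τ = 0)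
    (hSZ : ∀ χ ∈ SZ, ∀ i, χ ⬝ᵥ x i = 0)
    (hsep : ∀ s, (∀ i, z i ⬝ᵥ s = 0) → (∀ χ ∈ SZ, χ ⬝ᵥ s = 0) → s = 0)
    (hgen : ∀ t, (∀ i, t ⬝ᵥ x i = 0) → (∀ τ ∈ SX, t ⬝ᵥ τ = 0) → t = 0) :
    Algebra.adjoin ℂ ((fun τ => pauli τ 0) '' SX ∪ (fun χ => pauli 0 χ) '' SZ) =
      (rightEmb (logicEquiv hzx)).range := by
  apply le_antisymm
  · refine Algebra.adjoin_le (Set.union_subset ?_ ?_)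
    · rintro _ ⟨τ, hτ, rfl⟩
      exact pauli_mem_range_rightEmb hzx (hSX τ hτ) (by simp)
    · rintro _ ⟨χ, hχ, rfl⟩
      exact pauli_mem_range_rightEmb hzx (by simp) (hSZ χ hχ)
  · set 𝒜 := Algebra.adjoin ℂ ((fun τ => pauli τ 0) '' SX ∪ (fun χ => pauli 0 χ) '' SZ)
    -- by duality, the generators span all translations that commute with the logical operators
    have hshift : ∀ k ∈ logicKer z, k ∈ shifts 𝒜 := by
      intro k hk
      by_contra hk'
      obtain ⟨f, hfk, hf⟩ := Submodule.exists_le_ker_of_notMem hk'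
      let t : ι → ZMod 2 := fun i => f (Pi.single i 1)
      have ht : ∀ s, f s = t ⬝ᵥ s := fun s => by
        conv_lhs => rw [pi_eq_sum_univ' s]
        rw [map_sum, dotProduct]
        refine Finset.sum_congr rfl fun i _ => ?_
        rw [map_smul, smul_eq_mul, mul_comm]
      have ht' : t + ∑ i, (t ⬝ᵥ x i) • z i = 0 := by
        refine hgen _ (fun j => ?_) fun τ hτ => ?_
        · rw [add_dotProduct, sum_dotProduct]
          simp only [smul_dotProduct, hzx, smul_eq_mul, mul_ite, mul_one, mul_zero,
            Finset.sum_ite_eq', Finset.mem_univ, if_true]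
          exact CharTwo.add_self_eq_zero _
        · rw [add_dotProduct, sum_dotProduct, ← ht]
          simp only [smul_dotProduct, hSX τ hτ, smul_zero, Finset.sum_const_zero, add_zero]
          exact hf (mem_shifts.mpr (Algebra.subset_adjoin (Or.inl ⟨τ, hτ, rfl⟩)))
      have := congrArg (· ⬝ᵥ k) ht'
      simp only [add_dotProduct, sum_dotProduct, smul_dotProduct, zero_dotProduct] at this
      rw [Finset.sum_eq_zero fun i _ => by rw [hk i, smul_zero], add_zero, ← ht] at this
      exact hfk this
    have htop : 𝒜.comap (rightEmb (logicEquiv hzx)) = ⊤ := by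
      refine eq_top_of_translation_of_diagonal (fun k => ?_) fun s t hst => ?_
      · rw [Subalgebra.mem_comap, rightEmb_translation]
        exact hshift k k.2
      · have hex : ∃ χ ∈ SZ, χ ⬝ᵥ ((s : ι → ZMod 2) - t) ≠ 0 := by
          by_contra hno
          push Not at hno
          refine hst (Subtype.ext (sub_eq_zero.mp (hsep _ (fun i => ?_) hno)))
          rw [dotProduct_sub, s.2 i, t.2 i, sub_zero]
        obtain ⟨χ, hχ, hne⟩ := hex
        refine ⟨fun k => sgn (χ ⬝ᵥ (k : ι → ZMod 2)), ?_, fun h => hne ?_⟩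
        · rw [Subalgebra.mem_comap, rightEmb_diagonal hzx (hSZ χ hχ)]
          exact Algebra.subset_adjoin (Or.inr ⟨χ, hχ, rfl⟩)
        · rw [dotProduct_sub, sgn_injective h, sub_self]
    rintro _ ⟨A, rfl⟩
    exact (htop ▸ Algebra.mem_top : A ∈ 𝒜.comap (rightEmb (logicEquiv hzx)))

end LogicalFactor

/-! ### The spectral gap from eigenfunctionals -/

section Spectral

variable {W : Type} [AddCommGroup W] [Module ℂ W] [FiniteDimensional ℂ W]

/-- A lower bound for the eigenvalues of the transpose of `T`, on the functionals that vanish on a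
fixed vector `w` in the kernel of `T`, implies that `w` spans the kernel and bounds the gap. -/
lemma ker_eq_span_and_le_spectralGap {T : W →ₗ[ℂ] W} {w : W} (hw : w ≠ 0) (hTw : T w = 0)
    (hdim : 1 < Module.finrank ℂ W) {c : ℝ} (hc : 0 < c)
    (h : ∀ (φ : W →ₗ[ℂ] ℂ) (z : ℂ), φ ≠ 0 → φ w = 0 → (∀ v, φ (T v) = z * φ v) → c ≤ z.re) :
    LinearMap.ker T = Submodule.span ℂ {w} ∧ c ≤ spectralGap T := by
  have hR : LinearMap.range T ⊔ Submodule.span ℂ {w} = ⊤ := by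
    by_contra hne
    obtain ⟨φ, hφ, hle⟩ := Submodule.exists_le_ker_of_lt_top _ (lt_top_iff_ne_top.mpr hne)
    have h0 := h φ 0 hφ (hle (Submodule.mem_sup_right (Submodule.mem_span_singleton_self w)))
      fun v => by
        rw [zero_mul]
        exact hle (Submodule.mem_sup_left ⟨v, rfl⟩)
    exact absurd h0 (not_le.mpr hc)
  have hspan := finrank_span_singleton (K := ℂ) hw
  have hrank := LinearMap.finrank_range_add_finrank_ker T
  have hsup := Submodule.finrank_add_le_finrank_add_finrank (LinearMap.range T)
    (Submodule.span ℂ {w})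
  rw [hR, finrank_top, hspan] at hsup
  have hle : Submodule.span ℂ {w} ≤ LinearMap.ker T := by
    rwa [Submodule.span_singleton_le_iff_mem, LinearMap.mem_ker]
  have hker : LinearMap.ker T = Submodule.span ℂ {w} :=
    (Submodule.eq_of_le_of_finrank_le hle (by omega)).symm
  have hwR : w ∉ LinearMap.range T := by
    intro hmem
    rw [sup_eq_left.mpr ((Submodule.span_singleton_le_iff_mem _ _).mpr hmem)] at hR
    rw [hR, finrank_top, hker, hspan] at hrank
    omega
  refine ⟨hker, le_csInf ?_ ?_⟩
  · -- on the range of `T`, the operator is injective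
    have hnt : Nontrivial (LinearMap.range T) :=
      Module.nontrivial_of_finrank_pos (R := ℂ) (by rw [hker, hspan] at hrank; omega)
    let T' : Module.End ℂ (LinearMap.range T) := T.restrict fun v _ => ⟨v, rfl⟩
    obtain ⟨z, hz⟩ := Module.End.exists_eigenvalue T'
    obtain ⟨⟨v, hv⟩, hvz⟩ := hz.exists_hasEigenvector
    have hTv : T v = z • v := congrArg Subtype.val hvz.apply_eq_smul
    have hv0 : v ≠ 0 := fun h0 => hvz.2 (Subtype.ext h0)
    refine ⟨z.re, z, Module.End.hasEigenvalue_of_hasEigenvector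
      ⟨Module.End.mem_eigenspace_iff.mpr hTv, hv0⟩, ?_, rfl⟩
    rintro rfl
    have hvk : v ∈ Submodule.span ℂ {w} := hker ▸ LinearMap.mem_ker.mpr (by rw [hTv, zero_smul])
    obtain ⟨d, rfl⟩ := Submodule.mem_span_singleton.mp hvk
    have hd : d ≠ 0 := fun h0 => hv0 (by rw [h0, zero_smul])
    exact hwR ((Submodule.smul_mem_iff _ hd).mp hv)
  · rintro _ ⟨z, hz, hz0, rfl⟩
    have hns : LinearMap.range (T - z • (1 : Module.End ℂ W)) ≠ ⊤ := by
      intro htop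
      obtain ⟨v, hv⟩ := hz.exists_hasEigenvector
      have hinj := LinearMap.injective_iff_surjective.mpr (LinearMap.range_eq_top.mp htop)
      refine hv.2 (hinj ?_)
      rw [map_zero, LinearMap.sub_apply, hv.apply_eq_smul, LinearMap.smul_apply,
        Module.End.one_apply, sub_self]
    obtain ⟨φ, hφ, hφle⟩ := Submodule.exists_le_ker_of_lt_top _ (lt_top_iff_ne_top.mpr hns)
    have heig : ∀ v, φ (T v) = z * φ v := fun v => by
      have := LinearMap.mem_ker.mp (hφle ⟨v, rfl⟩)
      rwa [LinearMap.sub_apply, map_sub, LinearMap.smul_apply, Module.End.one_apply, map_smul,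
        smul_eq_mul, sub_eq_zero] at this
    refine h φ z hφ ?_ heig
    have := heig w
    rw [hTw, map_zero, eq_comm, mul_eq_zero] at this
    exact this.resolve_left hz0

end Spectral

/-! ### Stabilizer codes on two spanning trees -/

section CodeFrame

variable {ι V : Type} [Fintype ι] [DecidableEq ι] [Fintype V] [DecidableEq V]

/-- The combinatorial content of the toric code: a `σ^x` tree `J` for the plaquettes, a disjoint
`σ^z` tree `J'` for the stars, and logical operators with supports `x i` and `z i` that commute with
all stabilizers and avoid `J'` and `J`, respectively. The field `separating` says that a product of
`σ^x` that commutes with all logical `Z`, plaquettes and `σ^z` of `J'` is trivial, and `generating`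
is the same for products of `σ^z`. -/
structure CodeFrame (star plaq : V → ι → ZMod 2) (fst snd fst' snd' : ι → V) (J J' : Finset ι)
    (x z : Fin 2 → ι → ZMod 2) : Prop where
  magnetic : IsSpanningTree plaq fst snd J
  electric : IsSpanningTree star fst' snd' J'
  disjoint : Disjoint J J'
  plaq_star : ∀ p v, plaq p ⬝ᵥ star v = 0
  z_x : ∀ i j, z i ⬝ᵥ x j = if i = j then 1 else 0
  z_star : ∀ i v, z i ⬝ᵥ star v = 0
  z_eq_zero : ∀ i, ∀ j ∈ J, z i j = 0
  plaq_x : ∀ p i, plaq p ⬝ᵥ x i = 0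
  x_eq_zero : ∀ i, ∀ j ∈ J', x i j = 0
  separating : ∀ s, (∀ i, z i ⬝ᵥ s = 0) → (∀ p, plaq p ⬝ᵥ s = 0) → (∀ j ∈ J', s j = 0) → s = 0
  generating : ∀ t, (∀ i, t ⬝ᵥ x i = 0) → (∀ v, t ⬝ᵥ star v = 0) → (∀ j ∈ J, t j = 0) → t = 0

/-- The Hamiltonian of a code with the given supports of star and plaquette operators. -/
def codeHamiltonian (star plaq : V → ι → ZMod 2) : Matrix (ι → ZMod 2) (ι → ZMod 2) ℂ :=
  -(∑ v, pauli (star v) 0) - ∑ p, pauli 0 (plaq p)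

/-- The local generator: `σ^x` couplings on `J` and `σ^z` couplings on `J'`. -/
def codeDavies (star plaq : V → ι → ZMod 2) (J J' : Finset ι) (β : ℝ) :
    Matrix (ι → ZMod 2) (ι → ZMod 2) ℂ →ₗ[ℂ] Matrix (ι → ZMod 2) (ι → ZMod 2) ℂ :=
  ∑ j ∈ J, davies β (codeHamiltonian star plaq) (pauli (Pi.single j 1) 0) +
    ∑ j ∈ J', davies β (codeHamiltonian star plaq) (pauli 0 (Pi.single j 1))

/-- The sum of the vectors of a face family over the set with indicator function `A`. -/
def chain (face : V → ι → ZMod 2) (A : V → ZMod 2) : ι → ZMod 2 := ∑ v, A v • face v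

lemma chain_add_single (face : V → ι → ZMod 2) (A : V → ZMod 2) (v : V) :
    chain face (A + Pi.single v 1) = chain face A + face v := by
  simp [chain, add_smul, Finset.sum_add_distrib, Pi.single_apply, ite_smul]

lemma chain_add (face : V → ι → ZMod 2) (A B : V → ZMod 2) :
    chain face (A + B) = chain face A + chain face B := by
  simp [chain, add_smul, Finset.sum_add_distrib]

lemma chain_zero (face : V → ι → ZMod 2) : chain face 0 = 0 := by
  simp [chain]

lemma chain_single (face : V → ι → ZMod 2) (v : V) : chain face (Pi.single v 1) = face v := by
  rw [← zero_add (Pi.single v 1), chain_add_single, chain_zero, zero_add]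

lemma dotProduct_chain {face : V → ι → ZMod 2} {s : ι → ZMod 2} (h : ∀ v, s ⬝ᵥ face v = 0)
    (A : V → ZMod 2) : s ⬝ᵥ chain face A = 0 := by
  simp [chain, dotProduct_sum, dotProduct_smul, h]

lemma IsSpanningTree.chain_apply {face : V → ι → ZMod 2} {fst snd : ι → V} {J : Finset ι}
    (h : IsSpanningTree face fst snd J) (A : V → ZMod 2) (j : ι) :
    chain face A j = A (fst j) + A (snd j) := by
  simp [chain, Finset.sum_apply, h.face_apply, mul_add, Finset.sum_add_distrib, Pi.single_apply]

lemma IsSpanningTree.chain_const {face : V → ι → ZMod 2} {fst snd : ι → V} {J : Finset ι}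
    (h : IsSpanningTree face fst snd J) {A : V → ZMod 2} (hA : ∀ u v, A u = A v) :
    chain face A = 0 := by
  ext j
  rw [h.chain_apply, hA (fst j) (snd j)]
  exact CharTwo.add_self_eq_zero _

/-- The Pauli operators of the syndrome algebra: `η` and `ξ` are supported on the trees, `A` is a
set of plaquettes and `B` a set of stars. -/
def labelledPauli (star plaq : V → ι → ZMod 2) (η ξ : ι → ZMod 2) (A B : V → ZMod 2) :
    Matrix (ι → ZMod 2) (ι → ZMod 2) ℂ :=
  pauli (η + chain star B) (ξ + chain plaq A)

namespace CodeFrame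

variable {star plaq : V → ι → ZMod 2} {fst snd fst' snd' : ι → V} {J J' : Finset ι}
  {x z : Fin 2 → ι → ZMod 2}

lemma star_plaq (F : CodeFrame star plaq fst snd fst' snd' J J' x z) (v p : V) :
    star v ⬝ᵥ plaq p = 0 := by
  rw [dotProduct_comm, F.plaq_star]

lemma codeHamiltonian_eq (star plaq : V → ι → ZMod 2) : codeHamiltonian star plaq =
    -∑ k : V ⊕ V, pauli (Sum.elim star 0 k) (Sum.elim 0 plaq k) := by
  rw [Fintype.sum_sum_type, codeHamiltonian, neg_add']
  rfl

lemma self_comm (k : V ⊕ V) :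
    Sum.elim (0 : V → ι → ZMod 2) plaq k ⬝ᵥ Sum.elim star (0 : V → ι → ZMod 2) k = 0 := by
  rcases k with v | p <;> simp

lemma stab_comm (F : CodeFrame star plaq fst snd fst' snd' J J' x z) (k l : V ⊕ V) :
    Sum.elim (0 : V → ι → ZMod 2) plaq k ⬝ᵥ Sum.elim star (0 : V → ι → ZMod 2) l +
      Sum.elim (0 : V → ι → ZMod 2) plaq l ⬝ᵥ Sum.elim star (0 : V → ι → ZMod 2) k = 0 := by
  rcases k with v | p <;> rcases l with w | q <;> simp [F.plaq_star]

lemma flipsPair_magnetic (F : CodeFrame star plaq fst snd fst' snd' J J' x z) (j : ι) :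
    FlipsPair (codeHamiltonian star plaq) (pauli (Pi.single j 1) 0) (pauli 0 (plaq (fst j)))
      (pauli 0 (plaq (snd j))) := by
  have hne := F.magnetic.fst_ne_snd j
  rw [codeHamiltonian_eq]
  refine flipsPair_pauli self_comm F.stab_comm (by simp) (k₁ := Sum.inr (fst j))
    (k₂ := Sum.inr (snd j)) (fun h => hne (Sum.inr_injective h)) ?_ ?_ ?_
  · simp [F.magnetic.face_apply, Pi.single_eq_of_ne hne]
  · simp [F.magnetic.face_apply, Pi.single_eq_of_ne (Ne.symm hne)]
  · rintro (v | p) h₁ h₂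
    · simp
    · have h₁' : p ≠ fst j := fun h => h₁ (congrArg _ h)
      have h₂' : p ≠ snd j := fun h => h₂ (congrArg _ h)
      simp [F.magnetic.face_apply, Pi.single_eq_of_ne h₁', Pi.single_eq_of_ne h₂']

lemma flipsPair_electric (F : CodeFrame star plaq fst snd fst' snd' J J' x z) (j : ι) :
    FlipsPair (codeHamiltonian star plaq) (pauli 0 (Pi.single j 1)) (pauli (star (fst' j)) 0)
      (pauli (star (snd' j)) 0) := by
  have hne := F.electric.fst_ne_snd j
  rw [codeHamiltonian_eq]
  refine flipsPair_pauli self_comm F.stab_comm (by simp) (k₁ := Sum.inl (fst' j))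
    (k₂ := Sum.inl (snd' j)) (fun h => hne (Sum.inl_injective h)) ?_ ?_ ?_
  · simp [F.electric.face_apply, Pi.single_eq_of_ne hne]
  · simp [F.electric.face_apply, Pi.single_eq_of_ne (Ne.symm hne)]
  · rintro (v | p) h₁ h₂
    · have h₁' : v ≠ fst' j := fun h => h₁ (congrArg _ h)
      have h₂' : v ≠ snd' j := fun h => h₂ (congrArg _ h)
      simp [F.electric.face_apply, Pi.single_eq_of_ne h₁', Pi.single_eq_of_ne h₂']
    · simp

lemma davies_magnetic (F : CodeFrame star plaq fst snd fst' snd' J J' x z) (β : ℝ)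
    {η ξ : ι → ZMod 2} {j : ι} (hξ : ξ j = 0) (A B : V → ZMod 2) :
    davies β (codeHamiltonian star plaq) (pauli (Pi.single j 1) 0)
        (labelledPauli star plaq η ξ A B) =
      -edgeOp (tilt β) (fun p => plaq p ⬝ᵥ η) (fst j) (snd j)
        (fun A => labelledPauli star plaq η ξ A B) A := by
  have hτ : ∀ p, plaq p ⬝ᵥ (η + chain star B) = plaq p ⬝ᵥ η := fun p => by
    rw [dotProduct_add, dotProduct_chain (F.plaq_star p), add_zero]
  have hright : ∀ p, labelledPauli star plaq η ξ A B * pauli 0 (plaq p) =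
      sgn (plaq p ⬝ᵥ η) • (pauli 0 (plaq p) * labelledPauli star plaq η ξ A B) := fun p => by
    rw [labelledPauli, pauli_mul_comm, dotProduct_zero, zero_add, hτ]
  have hleft : ∀ p A, pauli 0 (plaq p) * labelledPauli star plaq η ξ A B =
      sgn (plaq p ⬝ᵥ η) • labelledPauli star plaq η ξ (A + Pi.single p 1) B := fun p A => by
    rw [labelledPauli, pauli_mul, hτ, zero_add, labelledPauli, chain_add_single]
    congr 2
    abel
  refine (F.flipsPair_magnetic j).davies_eq_edgeOp β
    (g := fun A => labelledPauli star plaq η ξ A B) ?_ (hright _) (hright _) (fun h => ?_)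
    (fun h => ?_) (fun h => ?_) (hleft _) (hleft _)
  · rw [labelledPauli, pauli_mul_comm, zero_dotProduct, zero_add, dotProduct_single_one,
      Pi.add_apply, hξ, zero_add, F.magnetic.chain_apply]
  · rw [h, sgn_zero]
  · rw [h, sgn_zero]
  · rw [h, sgn_mul_self]

lemma davies_electric (F : CodeFrame star plaq fst snd fst' snd' J J' x z) (β : ℝ)
    {η ξ : ι → ZMod 2} {j : ι} (hη : η j = 0) (A B : V → ZMod 2) :
    davies β (codeHamiltonian star plaq) (pauli 0 (Pi.single j 1))
        (labelledPauli star plaq η ξ A B) =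
      -edgeOp (tilt β) (fun v => star v ⬝ᵥ ξ) (fst' j) (snd' j)
        (labelledPauli star plaq η ξ A) B := by
  have hχ : ∀ v, (ξ + chain plaq A) ⬝ᵥ star v = star v ⬝ᵥ ξ := fun v => by
    rw [dotProduct_comm, dotProduct_add, dotProduct_chain (F.star_plaq v), add_zero]
  have hright : ∀ v, labelledPauli star plaq η ξ A B * pauli (star v) 0 =
      sgn (star v ⬝ᵥ ξ) • (pauli (star v) 0 * labelledPauli star plaq η ξ A B) := fun v => by
    rw [labelledPauli, pauli_mul_comm, zero_dotProduct, add_zero, hχ]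
  have hleft : ∀ v B, pauli (star v) 0 * labelledPauli star plaq η ξ A B =
      (1 : ℂ) • labelledPauli star plaq η ξ A (B + Pi.single v 1) := fun v B => by
    rw [labelledPauli, pauli_mul, zero_dotProduct, sgn_zero, zero_add, labelledPauli,
      chain_add_single]
    congr 2
    abel
  refine (F.flipsPair_electric j).davies_eq_edgeOp β (g := labelledPauli star plaq η ξ A) ?_
    (hright _) (hright _) (fun _ => rfl) (fun _ => rfl) (fun _ => mul_one 1) (hleft _) (hleft _)
  rw [labelledPauli, pauli_mul_comm, dotProduct_zero, add_zero, single_one_dotProduct,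
    Pi.add_apply, hη, zero_add, F.electric.chain_apply]

/-- The local generator on the Pauli operators of the syndrome algebra. -/
lemma codeDavies_labelledPauli (F : CodeFrame star plaq fst snd fst' snd' J J' x z) (β : ℝ)
    {η ξ : ι → ZMod 2} (hη : ∀ j, j ∉ J → η j = 0) (hξ : ∀ j, j ∉ J' → ξ j = 0)
    (A B : V → ZMod 2) :
    codeDavies star plaq J J' β (labelledPauli star plaq η ξ A B) =
      -(∑ j ∈ J, edgeOp (tilt β) (fun p => plaq p ⬝ᵥ η) (fst j) (snd j)
          (fun A => labelledPauli star plaq η ξ A B) A +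
        ∑ j ∈ J', edgeOp (tilt β) (fun v => star v ⬝ᵥ ξ) (fst' j) (snd' j)
          (labelledPauli star plaq η ξ A) B) := by
  rw [codeDavies, LinearMap.add_apply, LinearMap.sum_apply, LinearMap.sum_apply, neg_add,
    ← Finset.sum_neg_distrib, ← Finset.sum_neg_distrib]
  exact congrArg₂ _
    (Finset.sum_congr rfl fun j hj =>
      F.davies_magnetic β (hξ j (Finset.disjoint_left.mp F.disjoint hj)) A B)
    (Finset.sum_congr rfl fun j hj =>
      F.davies_electric β (hη j (Finset.disjoint_right.mp F.disjoint hj)) A B)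

/-- The syndrome algebra of a code. -/
def syndrome (star plaq : V → ι → ZMod 2) (J J' : Finset ι) :
    Subalgebra ℂ (Matrix (ι → ZMod 2) (ι → ZMod 2) ℂ) :=
  Algebra.adjoin ℂ
    ((fun τ => pauli τ 0) '' (Set.range star ∪ (fun j => Pi.single j 1) '' (J : Set ι)) ∪
      (fun χ => pauli 0 χ) '' (Set.range plaq ∪ (fun j => Pi.single j 1) '' (J' : Set ι)))

lemma syndrome_eq_range (F : CodeFrame star plaq fst snd fst' snd' J J' x z) :
    syndrome star plaq J J' = (rightEmb (logicEquiv F.z_x)).range := by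
  refine adjoin_syndrome_eq_range F.z_x ?_ ?_ ?_ ?_
  · rintro _ (⟨v, rfl⟩ | ⟨j, hj, rfl⟩) i
    · exact F.z_star i v
    · simpa using F.z_eq_zero i j hj
  · rintro _ (⟨p, rfl⟩ | ⟨j, hj, rfl⟩) i
    · exact F.plaq_x p i
    · simpa using F.x_eq_zero i j hj
  · intro s hz hs
    exact F.separating s hz (fun p => hs _ (Or.inl ⟨p, rfl⟩)) fun j hj => by
      simpa using hs _ (Or.inr ⟨j, hj, rfl⟩)
  · intro t hx ht
    exact F.generating t hx (fun v => ht _ (Or.inl ⟨v, rfl⟩)) fun j hj => by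
      simpa using ht _ (Or.inr ⟨j, hj, rfl⟩)

lemma syndrome_le_span (star plaq : V → ι → ZMod 2) (J J' : Finset ι) :
    Subalgebra.toSubmodule (syndrome star plaq J J') ≤
      Submodule.span ℂ {M | ∃ η ξ A B, (∀ j, j ∉ J → η j = 0) ∧ (∀ j, j ∉ J' → ξ j = 0) ∧
        M = labelledPauli star plaq η ξ A B} := by
  set S := {M | ∃ η ξ A B, (∀ j, j ∉ J → η j = 0) ∧ (∀ j, j ∉ J' → ξ j = 0) ∧
    M = labelledPauli star plaq η ξ A B} with hS
  have hone : (1 : Matrix (ι → ZMod 2) (ι → ZMod 2) ℂ) ∈ S :=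
    ⟨0, 0, 0, 0, fun _ _ => rfl, fun _ _ => rfl, by simp [labelledPauli, chain_zero]⟩
  have hsingle : ∀ (I : Finset ι) (i : ι), i ∈ I → ∀ j, j ∉ I → (Pi.single i 1 : ι → ZMod 2) j = 0 :=
    fun I i hi j hj => Pi.single_eq_of_ne (by rintro rfl; exact hj hi) _
  have hmul : ∀ M ∈ S, ∀ M' ∈ S, M * M' ∈ Submodule.span ℂ S := by
    rintro _ ⟨η, ξ, A, B, hη, hξ, rfl⟩ _ ⟨η', ξ', A', B', hη', hξ', rfl⟩
    rw [labelledPauli, labelledPauli, pauli_mul]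
    refine Submodule.smul_mem _ _ (Submodule.subset_span ⟨η + η', ξ + ξ', A + A', B + B',
      fun j hj => by rw [Pi.add_apply, hη j hj, hη' j hj, add_zero],
      fun j hj => by rw [Pi.add_apply, hξ j hj, hξ' j hj, add_zero], ?_⟩)
    rw [labelledPauli, chain_add, chain_add, add_add_add_comm, add_add_add_comm ξ]
  have hle : Submodule.span ℂ S * Submodule.span ℂ S ≤ Submodule.span ℂ S := by
    rw [Submodule.span_mul_span, Submodule.span_le]
    rintro _ ⟨M, hM, M', hM', rfl⟩
    exact hmul M hM M' hM'
  intro M hM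
  refine Algebra.adjoin_induction (p := fun M _ => M ∈ Submodule.span ℂ S) ?_ ?_ ?_ ?_ hM
  · rintro _ (⟨_, ⟨v, rfl⟩ | ⟨j, hj, rfl⟩, rfl⟩ | ⟨_, ⟨p, rfl⟩ | ⟨j, hj, rfl⟩, rfl⟩) <;>
      apply Submodule.subset_span
    · exact ⟨0, 0, 0, Pi.single v 1, fun _ _ => rfl, fun _ _ => rfl,
        by simp [labelledPauli, chain_zero, chain_single]⟩
    · exact ⟨Pi.single j 1, 0, 0, 0, hsingle J j hj, fun _ _ => rfl,
        by simp [labelledPauli, chain_zero]⟩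
    · exact ⟨0, 0, Pi.single p 1, 0, fun _ _ => rfl, fun _ _ => rfl,
        by simp [labelledPauli, chain_zero, chain_single]⟩
    · exact ⟨0, Pi.single j 1, 0, 0, fun _ _ => rfl, hsingle J' j hj,
        by simp [labelledPauli, chain_zero]⟩
  · intro r
    rw [Algebra.algebraMap_eq_smul_one]
    exact Submodule.smul_mem _ _ (Submodule.subset_span hone)
  · exact fun _ _ _ _ h h' => add_mem h h'
  · exact fun _ _ _ _ h h' => hle (Submodule.mul_mem_mul h h')

lemma labelledPauli_mem_syndrome (F : CodeFrame star plaq fst snd fst' snd' J J' x z)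
    {η ξ : ι → ZMod 2} (hη : ∀ j, j ∉ J → η j = 0) (hξ : ∀ j, j ∉ J' → ξ j = 0)
    (A B : V → ZMod 2) : labelledPauli star plaq η ξ A B ∈ syndrome star plaq J J' := by
  rw [F.syndrome_eq_range]
  refine pauli_mem_range_rightEmb F.z_x (fun i => ?_) fun i => ?_
  · rw [dotProduct_add, dotProduct_chain (F.z_star i), add_zero]
    refine Finset.sum_eq_zero fun j _ => ?_
    by_cases hj : j ∈ J
    · rw [F.z_eq_zero i j hj, zero_mul]
    · rw [hη j hj, mul_zero]
  · rw [dotProduct_comm, dotProduct_add, dotProduct_chain, add_zero]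
    · refine Finset.sum_eq_zero fun j _ => ?_
      by_cases hj : j ∈ J'
      · rw [F.x_eq_zero i j hj, zero_mul]
      · rw [hξ j hj, mul_zero]
    · intro p
      rw [dotProduct_comm, F.plaq_x]

lemma codeDavies_mem_syndrome (F : CodeFrame star plaq fst snd fst' snd' J J' x z) (β : ℝ)
    {M : Matrix (ι → ZMod 2) (ι → ZMod 2) ℂ} (hM : M ∈ syndrome star plaq J J') :
    codeDavies star plaq J J' β M ∈ syndrome star plaq J J' := by
  rw [codeDavies, LinearMap.add_apply, LinearMap.sum_apply, LinearMap.sum_apply]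
  have hX : ∀ v, pauli (star v) 0 ∈ syndrome star plaq J J' := fun v =>
    Algebra.subset_adjoin (Or.inl ⟨_, Or.inl ⟨v, rfl⟩, rfl⟩)
  have hZ : ∀ p, pauli 0 (plaq p) ∈ syndrome star plaq J J' := fun p =>
    Algebra.subset_adjoin (Or.inr ⟨_, Or.inl ⟨p, rfl⟩, rfl⟩)
  refine add_mem (sum_mem fun j hj => ?_) (sum_mem fun j hj => ?_)
  · exact (F.flipsPair_magnetic j).davies_mem β
      (Algebra.subset_adjoin (Or.inl ⟨_, Or.inr ⟨j, hj, rfl⟩, rfl⟩)) (hZ _) (hZ _) hM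
  · exact (F.flipsPair_electric j).davies_mem β
      (Algebra.subset_adjoin (Or.inr ⟨_, Or.inr ⟨j, hj, rfl⟩, rfl⟩)) (hX _) (hX _) hM

lemma codeDavies_mul_left (F : CodeFrame star plaq fst snd fst' snd' J J' x z) (β : ℝ)
    {X : Matrix (ι → ZMod 2) (ι → ZMod 2) ℂ} (hX : ∀ M ∈ syndrome star plaq J J', Commute X M)
    (M : Matrix (ι → ZMod 2) (ι → ZMod 2) ℂ) :
    codeDavies star plaq J J' β (X * M) = X * codeDavies star plaq J J' β M := by
  simp only [codeDavies, LinearMap.add_apply, LinearMap.sum_apply, mul_add, Finset.mul_sum]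
  have hs : ∀ v, Commute X (pauli (star v) 0) := fun v =>
    hX _ (Algebra.subset_adjoin (Or.inl ⟨_, Or.inl ⟨v, rfl⟩, rfl⟩))
  have hp : ∀ p, Commute X (pauli 0 (plaq p)) := fun p =>
    hX _ (Algebra.subset_adjoin (Or.inr ⟨_, Or.inl ⟨p, rfl⟩, rfl⟩))
  refine congrArg₂ _ (Finset.sum_congr rfl fun j hj => ?_) (Finset.sum_congr rfl fun j hj => ?_)
  · exact (F.flipsPair_magnetic j).davies_mul_left β
      (hX _ (Algebra.subset_adjoin (Or.inl ⟨_, Or.inr ⟨j, hj, rfl⟩, rfl⟩))) (hp _) (hp _) M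
  · exact (F.flipsPair_electric j).davies_mul_left β
      (hX _ (Algebra.subset_adjoin (Or.inr ⟨_, Or.inr ⟨j, hj, rfl⟩, rfl⟩))) (hs _) (hs _) M

/-- The eigenvalues of the transpose of the negative generator on the syndrome algebra. -/
lemma le_re_of_eigenfunctional (F : CodeFrame star plaq fst snd fst' snd' J J' x z) {β : ℝ}
    (hβ : 0 < β) (hV : 3 ≤ Fintype.card V) {ζ : ℂ}
    {φ : Matrix (ι → ZMod 2) (ι → ZMod 2) ℂ →ₗ[ℂ] ℂ} (hφ₁ : φ 1 = 0)
    (hφ : ∃ M ∈ syndrome star plaq J J', φ M ≠ 0)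
    (heig : ∀ M ∈ syndrome star plaq J J', φ (-codeDavies star plaq J J' β M) = ζ * φ M) :
    min (1 / 6) (max (2 * (1 - tilt β)) (2 / (Fintype.card V : ℝ) ^ 2)) ≤ ζ.re := by
  have hex : ∃ η ξ, (∀ j, j ∉ J → η j = 0) ∧ (∀ j, j ∉ J' → ξ j = 0) ∧
      ∃ A B, φ (labelledPauli star plaq η ξ A B) ≠ 0 := by
    by_contra hno
    push Not at hno
    obtain ⟨M, hM, hne⟩ := hφ
    have hle : Submodule.span ℂ {M | ∃ η ξ A B, (∀ j, j ∉ J → η j = 0) ∧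
        (∀ j, j ∉ J' → ξ j = 0) ∧ M = labelledPauli star plaq η ξ A B} ≤ LinearMap.ker φ := by
      rw [Submodule.span_le]
      rintro _ ⟨η, ξ, A, B, hη, hξ, rfl⟩
      exact hno η ξ hη hξ A B
    exact hne (hle (syndrome_le_span star plaq J J' hM))
  obtain ⟨η, ξ, hη, hξ, hne⟩ := hex
  refine le_re_of_trees (tilt_nonneg hβ) (tilt_le_one β) hV F.magnetic F.electric
    (a := fun p => plaq p ⬝ᵥ η) (a' := fun v => star v ⬝ᵥ ξ)
    (g := fun A B => φ (labelledPauli star plaq η ξ A B)) (fun A B => ?_) hne ?_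
  · rw [← heig _ (F.labelledPauli_mem_syndrome hη hξ A B), F.codeDavies_labelledPauli β hη hξ,
      neg_neg, map_add, map_sum, map_sum]
    simp only [map_edgeOp]
  · intro ha ha' A B hA hB
    have hη0 : η = 0 := F.magnetic.acyclic η hη (congrFun ha)
    have hξ0 : ξ = 0 := F.electric.acyclic ξ hξ (congrFun ha')
    have hone : labelledPauli star plaq η ξ A B = 1 := by
      rw [labelledPauli, hη0, hξ0, F.magnetic.chain_const hA, F.electric.chain_const hB]
      simp
    simp only [hone, hφ₁]

/-- The generator on the syndrome factor, for any factorization of the basis labels under which the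
syndrome algebra is the second factor. -/
lemma exists_syndrome_generator (F : CodeFrame star plaq fst snd fst' snd' J J' x z)
    (hV : 3 ≤ Fintype.card V) {a b : Type} [Fintype a] [DecidableEq a] [Nonempty a] [Fintype b]
    [DecidableEq b] (hb : 1 < Fintype.card b) (e : (ι → ZMod 2) ≃ a × b)
    (he : syndrome star plaq J J' = (rightEmb e).range) {β : ℝ} (hβ : 0 < β) :
    ∃ L : Matrix b b ℂ →ₗ[ℂ] Matrix b b ℂ,
      (∀ A B, codeDavies star plaq J J' β ((A ⊗ₖ B).submatrix e e) =
        (A ⊗ₖ L B).submatrix e e) ∧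
      LinearMap.ker L = Submodule.span ℂ {1} ∧
      min (1 / 6) (max (2 * (1 - tilt β)) (2 / (Fintype.card V : ℝ) ^ 2)) ≤ spectralGap (-L) := by
  have hinj : LinearMap.ker (rightEmb e).toLinearMap = ⊥ :=
    LinearMap.ker_eq_bot.mpr (rightEmb_injective e)
  obtain ⟨r, hr⟩ := LinearMap.exists_leftInverse_of_injective _ hinj
  have hr' : ∀ B, r (rightEmb e B) = B := fun B => congrArg (fun f => f B) hr
  have hmem : ∀ B, rightEmb e B ∈ syndrome star plaq J J' := fun B => he ▸ ⟨B, rfl⟩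
  let L : Matrix b b ℂ →ₗ[ℂ] Matrix b b ℂ :=
    r ∘ₗ codeDavies star plaq J J' β ∘ₗ (rightEmb e).toLinearMap
  have hL : ∀ B, rightEmb e (L B) = codeDavies star plaq J J' β (rightEmb e B) := fun B => by
    obtain ⟨B', hB'⟩ : codeDavies star plaq J J' β (rightEmb e B) ∈ (rightEmb e).range :=
      he ▸ F.codeDavies_mem_syndrome β (hmem B)
    have hB'' : rightEmb e B' = codeDavies star plaq J J' β (rightEmb e B) := hB'
    have : L B = B' := by
      change r (codeDavies star plaq J J' β (rightEmb e B)) = B'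
      rw [← hB'', hr']
    rw [this, hB'']
  have hb₀ : Nonempty b := Fintype.card_pos_iff.mp (by omega)
  have hone : L 1 = 0 := by
    apply rightEmb_injective e
    have h1 : (1 : Matrix (ι → ZMod 2) (ι → ZMod 2) ℂ) = labelledPauli star plaq 0 0 0 0 := by
      simp [labelledPauli, chain_zero]
    rw [hL, map_one, map_zero, h1, F.codeDavies_labelledPauli β (η := 0) (ξ := 0)
      (fun _ _ => rfl) fun _ _ => rfl]
    simp [edgeOp]
  have hcard : (0 : ℝ) < Fintype.card V := by
    exact_mod_cast (by omega : 0 < Fintype.card V)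
  have hgap := ker_eq_span_and_le_spectralGap (T := -L) (w := 1) one_ne_zero
    (by rw [LinearMap.neg_apply, hone, neg_zero])
    (by
      rw [Module.finrank_matrix, Module.finrank_self, mul_one]
      exact Nat.one_lt_mul_iff.mpr (by omega))
    (c := min (1 / 6) (max (2 * (1 - tilt β)) (2 / (Fintype.card V : ℝ) ^ 2)))
    (lt_min (by norm_num) (lt_max_of_lt_right (by positivity))) (by
      intro φ ζ hφ hφ₁ heig
      refine F.le_re_of_eigenfunctional hβ hV (φ := φ ∘ₗ r) ?_ ?_ ?_
      · rw [LinearMap.comp_apply, ← map_one (rightEmb e), hr', hφ₁]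
      · by_contra hno
        push Not at hno
        refine hφ (LinearMap.ext fun B => ?_)
        have := hno _ (hmem B)
        rwa [LinearMap.comp_apply, hr'] at this
      · intro M hM
        rw [he] at hM
        obtain ⟨B, rfl⟩ := hM
        change φ (r (-codeDavies star plaq J J' β (rightEmb e B))) = ζ * φ (r (rightEmb e B))
        rw [← hL, ← map_neg (rightEmb e), hr', hr']
        exact heig B)
  refine ⟨L, fun A B => ?_, ?_, hgap.2⟩
  · rw [← leftEmb_mul_rightEmb, ← leftEmb_mul_rightEmb, hL]
    refine F.codeDavies_mul_left β (fun M hM => ?_) _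
    rw [he] at hM
    obtain ⟨B, rfl⟩ := hM
    exact leftEmb_commute_rightEmb e A B
  · rw [← hgap.1]
    ext B
    simp

end CodeFrame

end CodeFrame

/-! ### The square lattice on the torus -/

section Lattice

/-- The indicator vector of a set of qubits. -/
def indicator {ι : Type} [DecidableEq ι] (A : Finset ι) : ι → ZMod 2 :=
  ∑ j ∈ A, Pi.single j 1

lemma indicator_apply {ι : Type} [DecidableEq ι] (A : Finset ι) (j : ι) :
    indicator A j = if j ∈ A then 1 else 0 := by
  simp [indicator, Finset.sum_apply, Pi.single_apply]

lemma indicator_dotProduct {ι : Type} [Fintype ι] [DecidableEq ι] (A : Finset ι)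
    (s : ι → ZMod 2) : indicator A ⬝ᵥ s = ∑ j ∈ A, s j := by
  rw [indicator, sum_dotProduct]
  simp

variable {L : ℕ}

lemma sigmaX_eq_pauli (j : Spin L) : sigmaX j = pauli (Pi.single j 1) 0 := by
  ext s t
  simp [sigmaX, pauli_apply]

lemma sigmaZ_eq_pauli (j : Spin L) : sigmaZ j = pauli 0 (Pi.single j 1) := by
  ext s t
  simp only [sigmaZ, Matrix.diagonal_apply, pauli_apply, add_zero, single_one_dotProduct, sgn]
  split_ifs with h₁ h₂ h₃ h₃ <;> simp_all

lemma prodX_eq_pauli (A : Finset (Spin L)) : prodX A = pauli (indicator A) 0 := by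
  have h : ∀ (A : Finset (Spin L)) (hA : (A : Set (Spin L)).Pairwise (Function.onFun Commute sigmaX)),
      A.noncommProd sigmaX hA = pauli (indicator A) 0 := by
    intro A
    induction A using Finset.induction_on with
    | empty => simp [indicator]
    | insert j A hj ih =>
      intro hA
      rw [Finset.noncommProd_insert_of_notMem _ _ _ _ hj, ih, sigmaX_eq_pauli, ← pauli_add_left,
        indicator, indicator, Finset.sum_insert hj]
  exact h A _

lemma prodZ_eq_pauli (A : Finset (Spin L)) : prodZ A = pauli 0 (indicator A) := by
  have h : ∀ (A : Finset (Spin L)) (hA : (A : Set (Spin L)).Pairwise (Function.onFun Commute sigmaZ)),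
      A.noncommProd sigmaZ hA = pauli 0 (indicator A) := by
    intro A
    induction A using Finset.induction_on with
    | empty => simp [indicator]
    | insert j A hj ih =>
      intro hA
      rw [Finset.noncommProd_insert_of_notMem _ _ _ _ hj, ih, sigmaZ_eq_pauli, ← pauli_add_right,
        indicator, indicator, Finset.sum_insert hj]
  exact h A _

variable [NeZero L]

lemma last_eq_neg_one : Fin.ofNat L (L - 1) = -1 := by
  rw [eq_neg_iff_add_eq_zero]
  ext
  have := NeZero.pos L
  simp [Fin.val_add, Nat.sub_add_cancel this]

lemma val_eq_pred_iff (r : Fin L) : r.val = L - 1 ↔ r = -1 := by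
  have := NeZero.pos L
  rw [← last_eq_neg_one, Fin.ext_iff, Fin.val_ofNat, Nat.mod_eq_of_lt (by omega)]

lemma one_ne_zero_of_two_le (hL : 2 ≤ L) : (1 : Fin L) ≠ 0 := by
  intro h
  have := congrArg Fin.val h
  rw [Fin.val_one', Fin.val_zero, Nat.mod_eq_of_lt (by omega)] at this
  exact one_ne_zero this

lemma val_add_one_of_ne {r : Fin L} (hr : r ≠ -1) : (r + 1).val = r.val + 1 := by
  have h := (val_eq_pred_iff r).not.mpr hr
  have := r.isLt
  rw [Fin.val_add, Fin.val_one', Nat.add_mod_mod, Nat.mod_eq_of_lt (by omega)]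

/-- A function on a cycle that does not change along any edge, except perhaps the one between the
last vertex and `0`, is constant. -/
lemma eq_apply_zero_of_cycle {α : Type} {f : Fin L → α} (h : ∀ c, c ≠ -1 → f c = f (c + 1))
    (c : Fin L) : f c = f 0 := by
  have hk : ∀ (k : ℕ) (hk : k < L), f ⟨k, hk⟩ = f 0 := by
    intro k
    induction k with
    | zero => exact fun _ => rfl
    | succ k ih =>
      intro hk
      have hlt : k < L := by omega
      have hne : (⟨k, hlt⟩ : Fin L) ≠ -1 := fun e => by
        have := (val_eq_pred_iff _).mpr e
        simp only at this
        omega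
      rw [← ih hlt, h _ hne]
      congr 1
      ext
      rw [val_add_one_of_ne hne]
  exact hk c.val c.isLt

lemma sum_add_one (f : Fin L → ZMod 2) : ∑ c, f (c + 1) = ∑ c, f c :=
  Equiv.sum_comp (Equiv.addRight (1 : Fin L)) f

/-- A function on a cycle that does not change along any edge but one is constant. -/
lemma eq_apply_zero_of_cut_cycle {f : Fin L → ZMod 2} {a : Fin L} (h : ∀ c, c ≠ a → f c = f (c + 1))
    (c : Fin L) : f c = f 0 := by
  refine eq_apply_zero_of_cycle (fun c _ => ?_) c
  by_cases hc : c = a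
  · have hsum : ∑ c, (f (c + 1) - f c) = 0 := by
      rw [Finset.sum_sub_distrib, sum_add_one, sub_self]
    rw [Finset.sum_eq_single a (fun c _ hca => by rw [h c hca, sub_self]) (by simp)] at hsum
    rw [hc, ← sub_eq_zero.mp hsum]
  · exact h c hc

lemma turn_zero : turn (0 : Fin L) = -1 := by
  rw [turn, last_eq_neg_one]
  simp

/-- The vertically winding logical `X` loop runs through a row from one end to the other, or passes
it straight downwards. -/
lemma turn_add_one (r : Fin L) :
    if r ≠ 0 ∧ (r.val ≠ L - 1 ∨ L % 2 = 1) then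
      (turn r = 0 ∧ turn (r + 1) = -1) ∨ (turn r = -1 ∧ turn (r + 1) = 0)
    else turn r = turn (r + 1) := by
  have hr : r ≠ 0 ↔ r.val ≠ 0 := Fin.val_eq_zero_iff.not.symm
  have hlt := r.isLt
  simp only [hr]
  by_cases hlast : r = -1
  · have h1 : r + 1 = 0 := by rw [hlast, neg_add_cancel]
    have hval := (val_eq_pred_iff r).mpr hlast
    rw [h1, turn_zero]
    unfold turn
    rw [last_eq_neg_one]
    split_ifs <;> first | (simp; done) | grind
  · have h1 := val_add_one_of_ne hlast
    have h2 := (val_eq_pred_iff r).not.mpr hlast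
    unfold turn
    rw [last_eq_neg_one, h1]
    split_ifs <;> first | (simp; done) | grind

lemma hor_mem_snake {r c : Fin L} : hor r c ∈ snake L ↔ r ≠ 0 ∧ c = turn r := by
  simp [snake]

lemma ver_mem_snake {r c : Fin L} : ver r c ∈ snake L ↔ c ≠ 0 := by
  simp [snake]

lemma hor_mem_comb {r c : Fin L} : hor r c ∈ comb L ↔ c ≠ turn r := by
  simp [comb]

lemma ver_mem_comb {r c : Fin L} : ver r c ∈ comb L ↔ c = 0 ∧ r ≠ -1 := by
  simp [comb, val_eq_pred_iff]

/-- The two cells on the sides of an edge: this is the first one. -/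
def cellFst : Spin L → Fin L × Fin L := Sum.elim id id

/-- The second cell of an edge: above a horizontal edge, on the left of a vertical edge. -/
def cellSnd : Spin L → Fin L × Fin L := Sum.elim (fun e => (e.1 - 1, e.2)) fun e => (e.1, e.2 - 1)

/-- The first end point of an edge. -/
def nodeFst : Spin L → Fin L × Fin L := Sum.elim id id

/-- The second end point of an edge. -/
def nodeSnd : Spin L → Fin L × Fin L := Sum.elim (fun e => (e.1, e.2 + 1)) fun e => (e.1 + 1, e.2)

lemma indicator_nodeStar (hL : 2 ≤ L) (v : Fin L × Fin L) :
    indicator (nodeStar v) = Pi.single (hor v.1 v.2) 1 + (Pi.single (hor v.1 (v.2 - 1)) 1 +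
      (Pi.single (ver v.1 v.2) 1 + Pi.single (ver (v.1 - 1) v.2) 1)) := by
  have h1 := one_ne_zero_of_two_le hL
  obtain ⟨r, c⟩ := v
  rw [indicator, nodeStar, Finset.sum_insert, Finset.sum_insert, Finset.sum_insert,
    Finset.sum_singleton] <;> simp [h1, eq_comm (a := r), eq_comm (a := c)]

lemma indicator_plaquette (hL : 2 ≤ L) (p : Fin L × Fin L) :
    indicator (plaquette p) = Pi.single (hor p.1 p.2) 1 + (Pi.single (hor (p.1 + 1) p.2) 1 +
      (Pi.single (ver p.1 p.2) 1 + Pi.single (ver p.1 (p.2 + 1)) 1)) := by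
  have h1 := one_ne_zero_of_two_le hL
  obtain ⟨r, c⟩ := p
  rw [indicator, plaquette, Finset.sum_insert, Finset.sum_insert, Finset.sum_insert,
    Finset.sum_singleton] <;> simp [h1]

lemma nodeStar_dotProduct (hL : 2 ≤ L) (r c : Fin L) (s : Spin L → ZMod 2) :
    indicator (nodeStar (r, c)) ⬝ᵥ s =
      s (hor r c) + (s (hor r (c - 1)) + (s (ver r c) + s (ver (r - 1) c))) := by
  rw [indicator_nodeStar hL]
  simp [add_dotProduct]

lemma plaquette_dotProduct (hL : 2 ≤ L) (r c : Fin L) (s : Spin L → ZMod 2) :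
    indicator (plaquette (r, c)) ⬝ᵥ s =
      s (hor r c) + (s (hor (r + 1) c) + (s (ver r c) + s (ver r (c + 1)))) := by
  rw [indicator_plaquette hL]
  simp [add_dotProduct]

lemma plaquette_apply (hL : 2 ≤ L) (p : Fin L × Fin L) (j : Spin L) :
    indicator (plaquette p) j = Pi.single (M := fun _ => ZMod 2) (cellFst j) 1 p +
      Pi.single (M := fun _ => ZMod 2) (cellSnd j) 1 p := by
  obtain ⟨r, c⟩ := p
  rw [indicator_plaquette hL]
  rcases j with ⟨r', c'⟩ | ⟨r', c'⟩ <;>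
    simp [Pi.single_apply, cellFst, cellSnd, eq_sub_iff_add_eq, eq_comm (a := r'),
      eq_comm (a := c')]

lemma nodeStar_apply (hL : 2 ≤ L) (v : Fin L × Fin L) (j : Spin L) :
    indicator (nodeStar v) j = Pi.single (M := fun _ => ZMod 2) (nodeFst j) 1 v +
      Pi.single (M := fun _ => ZMod 2) (nodeSnd j) 1 v := by
  obtain ⟨r, c⟩ := v
  have h : ∀ a b : Fin L, a = b - 1 ↔ b = a + 1 := fun a b => by
    rw [eq_sub_iff_add_eq, eq_comm]
  rw [indicator_nodeStar hL]
  rcases j with ⟨r', c'⟩ | ⟨r', c'⟩ <;>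
    simp [Pi.single_apply, nodeFst, nodeSnd, h, eq_comm (b := r),
      eq_comm (b := c)]

/-- The snake visits all cells. -/
lemma isSpanningTree_snake (hL : 2 ≤ L) :
    IsSpanningTree (fun p => indicator (plaquette p)) cellFst cellSnd (snake L) where
  face_apply := plaquette_apply hL
  fst_ne_snd := by
    have h1 := one_ne_zero_of_two_le hL
    rintro (⟨r, c⟩ | ⟨r, c⟩) <;> simp [cellFst, cellSnd, h1, eq_comm (a := r), eq_comm (a := c)]
  connected A hA := by
    have hrow : ∀ r c, A (r, c) = A (r, 0) := fun r c => by
      refine eq_apply_zero_of_cycle (f := fun c => A (r, c)) (fun c hc => ?_) c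
      have := hA (ver r (c + 1)) (ver_mem_snake.mpr fun h0 => hc (eq_neg_of_add_eq_zero_left h0))
      simpa [cellFst, cellSnd] using this.symm
    have hcol : ∀ r, A (r, 0) = A (0, 0) := fun r => by
      refine eq_apply_zero_of_cycle (f := fun r => A (r, 0)) (fun r hr => ?_) r
      have := hA (hor (r + 1) (turn (r + 1)))
        (hor_mem_snake.mpr ⟨fun h0 => hr (eq_neg_of_add_eq_zero_left h0), rfl⟩)
      simp only [cellFst, cellSnd, Sum.elim_inl, id, add_sub_cancel_right] at this
      rw [hrow, hrow r] at this
      exact this.symm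
    rintro ⟨r, c⟩ ⟨r', c'⟩
    rw [hrow r, hrow r', hcol r, hcol r']
  acyclic η hη hface := by
    have hver : ∀ r, η (ver r 0) = 0 := fun r => hη _ fun h => ver_mem_snake.mp h rfl
    have hsum : ∀ r, ∑ c, η (hor r c) = η (hor r (turn r)) := fun r =>
      Finset.sum_eq_single _ (fun c _ hc => hη _ fun h => hc (hor_mem_snake.mp h).2) (by simp)
    have hstep : ∀ r, η (hor r (turn r)) = η (hor (r + 1) (turn (r + 1))) := fun r => by
      have h : ∑ c, indicator (plaquette (r, c)) ⬝ᵥ η = 0 :=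
        Finset.sum_eq_zero fun c _ => hface (r, c)
      simp only [plaquette_dotProduct hL, Finset.sum_add_distrib, hsum] at h
      rw [sum_add_one fun c => η (ver r c),
        CharTwo.add_self_eq_zero, add_zero] at h
      exact CharTwo.add_eq_zero.mp h
    have hturn : ∀ r, η (hor r (turn r)) = 0 := fun r => by
      rw [eq_apply_zero_of_cycle (f := fun r => η (hor r (turn r))) (fun r _ => hstep r) r]
      exact hη _ fun h => (hor_mem_snake.mp h).1 rfl
    have hhor : ∀ r c, η (hor r c) = 0 := fun r c => by
      by_cases hc : c = turn r
      · rw [hc, hturn]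
      · exact hη _ fun h => hc (hor_mem_snake.mp h).2
    ext (⟨r, c⟩ | ⟨r, c⟩)
    · exact hhor r c
    · refine (eq_apply_zero_of_cycle (f := fun c => η (ver r c)) (fun c _ => ?_) c).trans (hver r)
      have h := hface (r, c)
      rw [plaquette_dotProduct hL, hhor, hhor, zero_add, zero_add] at h
      exact CharTwo.add_eq_zero.mp h

/-- The comb visits all nodes. -/
lemma isSpanningTree_comb (hL : 2 ≤ L) :
    IsSpanningTree (fun v => indicator (nodeStar v)) nodeFst nodeSnd (comb L) where
  face_apply := nodeStar_apply hL
  fst_ne_snd := by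
    have h1 := one_ne_zero_of_two_le hL
    rintro (⟨r, c⟩ | ⟨r, c⟩) <;> simp [nodeFst, nodeSnd, h1]
  connected A hA := by
    have hrow : ∀ r c, A (r, c) = A (r, 0) := fun r c =>
      eq_apply_zero_of_cut_cycle (f := fun c => A (r, c)) (a := turn r)
        (fun c hc => hA (hor r c) (hor_mem_comb.mpr hc)) c
    have hcol : ∀ r, A (r, 0) = A (0, 0) := fun r =>
      eq_apply_zero_of_cycle (f := fun r => A (r, 0))
        (fun r hr => hA (ver r 0) (ver_mem_comb.mpr ⟨rfl, hr⟩)) r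
    rintro ⟨r, c⟩ ⟨r', c'⟩
    rw [hrow r, hrow r', hcol r, hcol r']
  acyclic ξ hξ hface := by
    have hver : ∀ r c, c ≠ 0 → ξ (ver r c) = 0 := fun r c hc =>
      hξ _ fun h => hc (ver_mem_comb.mp h).1
    have hhor : ∀ r c, ξ (hor r c) = 0 := fun r c => by
      have hconst : ∀ c, ξ (hor r c) = ξ (hor r 0) := fun c => by
        refine eq_apply_zero_of_cycle (f := fun c => ξ (hor r c)) (fun c hc => ?_) c
        have hc0 : c + 1 ≠ 0 := fun h0 => hc (eq_neg_of_add_eq_zero_left h0)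
        have h := hface (r, c + 1)
        rw [nodeStar_dotProduct hL, hver _ _ hc0, hver _ _ hc0, add_zero, add_zero,
          add_sub_cancel_right] at h
        exact (CharTwo.add_eq_zero.mp h).symm
      rw [hconst c, ← hconst (turn r)]
      exact hξ _ fun h => hor_mem_comb.mp h rfl
    have hcol : ∀ r, ξ (ver r 0) = ξ (ver 0 0) := fun r => by
      refine eq_apply_zero_of_cycle (f := fun r => ξ (ver r 0)) (fun r _ => ?_) r
      have h := hface (r + 1, 0)
      rw [nodeStar_dotProduct hL, hhor, hhor, zero_add, zero_add, add_sub_cancel_right] at h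
      exact (CharTwo.add_eq_zero.mp h).symm
    ext (⟨r, c⟩ | ⟨r, c⟩)
    · exact hhor r c
    · by_cases hc : c = 0
      · subst hc
        refine (hcol r).trans ((hcol (-1)).symm.trans ?_)
        exact hξ _ fun h => (ver_mem_comb.mp h).2 rfl
      · exact hver r c hc

variable (L) in
/-- The supports of the two logical `X`. -/
def logicX : Fin 2 → Spin L → ZMod 2 :=
  ![indicator (Finset.univ.image fun c : Fin L => ver (Fin.ofNat L (L - 1)) c),
    indicator (Finset.disjSum (Finset.univ.filter fun e => e.2 = turn e.1)
      (Finset.univ.filter fun e => e.2 ≠ 0 ∧ e.1 ≠ 0 ∧ (e.1.val ≠ L - 1 ∨ L % 2 = 1)))]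

variable (L) in
/-- The supports of the two logical `Z`. -/
def logicZ : Fin 2 → Spin L → ZMod 2 :=
  ![indicator (Finset.univ.image fun r : Fin L => ver r 0),
    indicator (Finset.univ.image fun c : Fin L => hor 0 c)]

lemma logicX_zero_hor (r c : Fin L) : logicX L 0 (hor r c) = 0 := by
  simp [logicX, indicator_apply]

lemma logicX_zero_ver (r c : Fin L) : logicX L 0 (ver r c) = if r = -1 then 1 else 0 := by
  simp only [logicX, Matrix.cons_val_zero, indicator_apply, last_eq_neg_one]
  simp [eq_comm]

lemma logicX_one_hor (r c : Fin L) : logicX L 1 (hor r c) = if c = turn r then 1 else 0 := by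
  simp [logicX, indicator_apply]

lemma logicX_one_ver (r c : Fin L) : logicX L 1 (ver r c) =
    if c ≠ 0 ∧ r ≠ 0 ∧ (r.val ≠ L - 1 ∨ L % 2 = 1) then 1 else 0 := by
  simp [logicX, indicator_apply]

lemma logicX_zero_dotProduct (s : Spin L → ZMod 2) :
    logicX L 0 ⬝ᵥ s = ∑ c, s (ver (-1) c) := by
  rw [logicX, Matrix.cons_val_zero, indicator_dotProduct, last_eq_neg_one, Finset.sum_image]
  intro c _ c' _ h
  simpa using h

lemma logicZ_zero_dotProduct (s : Spin L → ZMod 2) :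
    logicZ L 0 ⬝ᵥ s = ∑ r, s (ver r 0) := by
  rw [logicZ, Matrix.cons_val_zero, indicator_dotProduct, Finset.sum_image]
  intro c _ c' _ h
  simpa using h

lemma logicZ_one_dotProduct (s : Spin L → ZMod 2) :
    logicZ L 1 ⬝ᵥ s = ∑ c, s (hor 0 c) := by
  rw [logicZ, Matrix.cons_val_one, Matrix.cons_val_zero, indicator_dotProduct, Finset.sum_image]
  intro c _ c' _ h
  simpa using h

lemma logicZ_eq_zero (i : Fin 2) {j : Spin L} (hj : j ∈ snake L) : logicZ L i j = 0 := by
  rcases j with ⟨r, c⟩ | ⟨r, c⟩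
  · have := (hor_mem_snake.mp hj).1
    fin_cases i <;> simp [logicZ, indicator_apply, Ne.symm this]
  · have := ver_mem_snake.mp hj
    fin_cases i <;> simp [logicZ, indicator_apply, Ne.symm this]

lemma logicX_eq_zero (i : Fin 2) {j : Spin L} (hj : j ∈ comb L) : logicX L i j = 0 := by
  rcases j with ⟨r, c⟩ | ⟨r, c⟩
  · have := hor_mem_comb.mp hj
    fin_cases i
    · exact logicX_zero_hor r c
    · exact (logicX_one_hor r c).trans (if_neg this)
  · have := ver_mem_comb.mp hj
    fin_cases i
    · exact (logicX_zero_ver r c).trans (if_neg this.2)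
    · exact (logicX_one_ver r c).trans (if_neg fun h => h.1 this.1)

lemma plaquette_dotProduct_logicX (hL : 2 ≤ L) (p : Fin L × Fin L) (i : Fin 2) :
    indicator (plaquette p) ⬝ᵥ logicX L i = 0 := by
  obtain ⟨r, c⟩ := p
  rw [plaquette_dotProduct hL]
  fin_cases i
  · change logicX L 0 _ + (logicX L 0 _ + (logicX L 0 _ + logicX L 0 _)) = 0
    rw [logicX_zero_hor, logicX_zero_hor, logicX_zero_ver, logicX_zero_ver, zero_add, zero_add]
    exact CharTwo.add_self_eq_zero _
  · change logicX L 1 _ + (logicX L 1 _ + (logicX L 1 _ + logicX L 1 _)) = 0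
    rw [logicX_one_hor, logicX_one_hor, logicX_one_ver, logicX_one_ver]
    have hc : c + 1 ≠ 0 ↔ c ≠ -1 := by rw [ne_eq, ne_eq, eq_neg_iff_add_eq_zero]
    have h2 : ∀ (P Q : Prop) [Decidable P] [Decidable Q],
        (if P then (1 : ZMod 2) else 0) + ((if Q then 1 else 0) +
          ((if ¬P then 1 else 0) + (if ¬Q then 1 else 0))) = 0 := by
      intro P Q _ _
      by_cases hP : P <;> by_cases hQ : Q <;> simp [hP, hQ] <;> rfl
    have hturn := turn_add_one r
    by_cases hr : r ≠ 0 ∧ (r.val ≠ L - 1 ∨ L % 2 = 1)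
    · rw [if_pos hr] at hturn
      rw [if_congr (and_iff_left hr) rfl rfl, if_congr ((and_iff_left hr).trans hc) rfl rfl]
      rcases hturn with ⟨h, h'⟩ | ⟨h, h'⟩
      · rw [h, h']
        exact h2 (c = 0) (c = -1)
      · rw [h, h', add_left_comm]
        exact h2 (c = 0) (c = -1)
    · rw [if_neg hr] at hturn
      have hP : ∀ P : Prop, ¬(P ∧ r ≠ 0 ∧ (r.val ≠ L - 1 ∨ L % 2 = 1)) := fun P h => hr h.2
      rw [if_neg (hP _), if_neg (hP _), hturn, add_zero, add_zero]
      exact CharTwo.add_self_eq_zero _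

lemma plaquette_dotProduct_nodeStar (hL : 2 ≤ L) (p v : Fin L × Fin L) :
    indicator (plaquette p) ⬝ᵥ indicator (nodeStar v) = 0 := by
  obtain ⟨r, c⟩ := p
  rw [plaquette_dotProduct hL]
  simp only [nodeStar_apply hL, nodeFst, nodeSnd, Sum.elim_inl, Sum.elim_inr, id]
  generalize Pi.single (M := fun _ => ZMod 2) (r, c) 1 v = w₁
  generalize Pi.single (M := fun _ => ZMod 2) (r, c + 1) 1 v = w₂
  generalize Pi.single (M := fun _ => ZMod 2) (r + 1, c) 1 v = w₃
  generalize Pi.single (M := fun _ => ZMod 2) (r + 1, c + 1) 1 v = w₄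
  revert w₁ w₂ w₃ w₄
  decide

lemma logicZ_dotProduct_nodeStar (hL : 2 ≤ L) (i : Fin 2) (v : Fin L × Fin L) :
    logicZ L i ⬝ᵥ indicator (nodeStar v) = 0 := by
  fin_cases i
  · refine (logicZ_zero_dotProduct _).trans ?_
    simp only [nodeStar_apply hL, nodeFst, nodeSnd, Sum.elim_inr, id, Finset.sum_add_distrib]
    rw [sum_add_one fun r => Pi.single (M := fun _ => ZMod 2) (r, (0 : Fin L)) 1 v]
    exact CharTwo.add_self_eq_zero _
  · refine (logicZ_one_dotProduct _).trans ?_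
    simp only [nodeStar_apply hL, nodeFst, nodeSnd, Sum.elim_inl, id, Finset.sum_add_distrib]
    rw [sum_add_one fun c => Pi.single (M := fun _ => ZMod 2) ((0 : Fin L), c) 1 v]
    exact CharTwo.add_self_eq_zero _

lemma logicZ_dotProduct_logicX (i j : Fin 2) :
    logicZ L i ⬝ᵥ logicX L j = if i = j then 1 else 0 := by
  fin_cases i <;> fin_cases j
  · refine (logicZ_zero_dotProduct _).trans ?_
    simp [logicX_zero_ver]
  · refine (logicZ_zero_dotProduct _).trans ?_
    simp [logicX_one_ver]
  · refine (logicZ_one_dotProduct _).trans ?_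
    simp [logicX_zero_hor]
  · refine (logicZ_one_dotProduct _).trans ?_
    simp [logicX_one_hor]

lemma codeFrame_toric (hL : 2 ≤ L) :
    CodeFrame (fun v => indicator (nodeStar v)) (fun p => indicator (plaquette p)) cellFst cellSnd
      nodeFst nodeSnd (snake L) (comb L) (logicX L) (logicZ L) where
  magnetic := isSpanningTree_snake hL
  electric := isSpanningTree_comb hL
  disjoint := by
    rw [Finset.disjoint_left]
    rintro (⟨r, c⟩ | ⟨r, c⟩) h h'
    · exact hor_mem_comb.mp h' (hor_mem_snake.mp h).2
    · exact ver_mem_snake.mp h (ver_mem_comb.mp h').1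
  plaq_star := plaquette_dotProduct_nodeStar hL
  z_x := logicZ_dotProduct_logicX
  z_star := logicZ_dotProduct_nodeStar hL
  z_eq_zero := fun i _ => logicZ_eq_zero i
  plaq_x := plaquette_dotProduct_logicX hL
  x_eq_zero := fun i _ => logicX_eq_zero i
  separating s hz hp hs := by
    refine (isSpanningTree_snake hL).acyclic s (fun j hj => ?_) hp
    by_cases hj' : j ∈ comb L
    · exact hs j hj'
    -- only the two edges outside of both trees are left, and each lies on one of the loops
    rcases j with ⟨r, c⟩ | ⟨r, c⟩
    · have hc : c = turn r := by_contra fun h => hj' (hor_mem_comb.mpr h)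
      have hr : r = 0 := by_contra fun h => hj (hor_mem_snake.mpr ⟨h, hc⟩)
      have h := hz 1
      rw [logicZ_one_dotProduct, Finset.sum_eq_single (turn 0)
        (fun c _ hc => hs _ (hor_mem_comb.mpr hc)) (by simp)] at h
      rw [hc, hr]
      exact h
    · have hc : c = 0 := by_contra fun h => hj (ver_mem_snake.mpr h)
      have hr : r = -1 := by_contra fun h => hj' (ver_mem_comb.mpr ⟨hc, h⟩)
      have h := hz 0
      rw [logicZ_zero_dotProduct, Finset.sum_eq_single (-1)
        (fun r _ hr => hs _ (ver_mem_comb.mpr ⟨rfl, hr⟩)) (by simp)] at h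
      rw [hc, hr]
      exact h
  generating t hx hv ht := by
    refine (isSpanningTree_comb hL).acyclic t (fun j hj => ?_)
      fun v => (dotProduct_comm _ _).trans (hv v)
    by_cases hj' : j ∈ snake L
    · exact ht j hj'
    rcases j with ⟨r, c⟩ | ⟨r, c⟩
    · have hc : c = turn r := by_contra fun h => hj (hor_mem_comb.mpr h)
      have hr : r = 0 := by_contra fun h => hj' (hor_mem_snake.mpr ⟨h, hc⟩)
      have h := hx 1
      rw [dotProduct, Finset.sum_eq_single (hor 0 (turn 0)), logicX_one_hor, if_pos rfl,
        mul_one] at h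
      · rw [hc, hr]
        exact h
      · rintro (⟨r, c⟩ | ⟨r, c⟩) _ hne
        · rw [logicX_one_hor]
          split_ifs with hturn
          · rw [ht _ (hor_mem_snake.mpr ⟨fun h0 => hne (by rw [hturn, h0]), hturn⟩), zero_mul]
          · rw [mul_zero]
        · rw [logicX_one_ver]
          split_ifs with hver
          · rw [ht _ (ver_mem_snake.mpr hver.1), zero_mul]
          · rw [mul_zero]
      · simp
    · have hc : c = 0 := by_contra fun h => hj' (ver_mem_snake.mpr h)
      have hr : r = -1 := by_contra fun h => hj (ver_mem_comb.mpr ⟨hc, h⟩)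
      have h := hx 0
      rw [dotProduct_comm, logicX_zero_dotProduct, Finset.sum_eq_single 0
        (fun c _ hc => ht _ (ver_mem_snake.mpr hc)) (by simp)] at h
      rw [hc, hr]
      exact h

lemma hamiltonian_eq : hamiltonian L = codeHamiltonian (fun v => indicator (nodeStar v))
    (fun p => indicator (plaquette p)) := by
  simp only [hamiltonian, codeHamiltonian, prodX_eq_pauli, prodZ_eq_pauli]

lemma localDavies_eq (β : ℝ) : localDavies L β = codeDavies (fun v => indicator (nodeStar v))
    (fun p => indicator (plaquette p)) (snake L) (comb L) β := by
  simp only [localDavies, codeDavies, hamiltonian_eq, sigmaX_eq_pauli, sigmaZ_eq_pauli]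

lemma logicAlgebra_eq : logicAlgebra L = Algebra.adjoin ℂ
    ((Set.range fun i => pauli (logicX L i) 0) ∪ Set.range fun i => pauli 0 (logicZ L i)) := by
  have h : ∀ M N : Fin 2 → Op L, Set.range M ∪ Set.range N = {M 0, N 0, M 1, N 1} := by
    intro M N
    ext X
    simp only [Set.mem_union, Set.mem_range, Fin.exists_fin_two, Set.mem_insert_iff,
      Set.mem_singleton_iff, eq_comm (b := X)]
    tauto
  rw [h, logicAlgebra, logicalX₁, logicalX₂, logicalZ₁, logicalZ₂, prodX_eq_pauli, prodX_eq_pauli,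
    prodZ_eq_pauli, prodZ_eq_pauli]
  rfl

lemma syndromeAlgebra_eq : syndromeAlgebra L =
    CodeFrame.syndrome (fun v => indicator (nodeStar v)) (fun p => indicator (plaquette p))
      (snake L) (comb L) := by
  rw [syndromeAlgebra, CodeFrame.syndrome]
  congr 1
  simp only [Set.image_union, ← Set.range_comp, Set.image_image, Function.comp_def,
    prodX_eq_pauli, prodZ_eq_pauli, sigmaX_eq_pauli, sigmaZ_eq_pauli]
  ext M
  simp only [Set.mem_union]
  tauto

lemma card_logicKer : Fintype.card (logicKer (logicZ L)) = 2 ^ (2 * L ^ 2 - 2) := by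
  have h := Fintype.card_congr (logicEquiv (logicZ_dotProduct_logicX (L := L)))
  have hpos : 1 ≤ L ^ 2 := Nat.one_le_pow _ _ (NeZero.pos L)
  simp only [Fintype.card_prod, Fintype.card_fun, Fintype.card_sum, Fintype.card_fin,
    ZMod.card] at h
  have hexp : L * L + L * L = 2 + (2 * L ^ 2 - 2) := by
    rw [← sq]
    omega
  rw [hexp, pow_add] at h
  exact (Nat.eq_of_mul_eq_mul_left (by norm_num) h).symm

variable (L) in
/-- The factorization of the computational basis into four logical labels and the labels of the
syndrome space. -/
def toricEquiv : Conf L ≃ Fin 4 × Fin (2 ^ (2 * L ^ 2 - 2)) :=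
  (logicEquiv (logicZ_dotProduct_logicX (L := L))).trans
    ((Fintype.equivFinOfCardEq (by simp)).prodCongr (Fintype.equivFinOfCardEq card_logicKer))

lemma logicAlgebra_eq_range : logicAlgebra L = (leftEmb (toricEquiv L)).range := by
  rw [logicAlgebra_eq, adjoin_logical_eq_range logicZ_dotProduct_logicX, toricEquiv,
    range_leftEmb_prodCongr]

lemma syndromeAlgebra_eq_range (hL : 2 ≤ L) :
    syndromeAlgebra L = (rightEmb (toricEquiv L)).range := by
  rw [syndromeAlgebra_eq, (codeFrame_toric hL).syndrome_eq_range, toricEquiv,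
    range_rightEmb_prodCongr]

end Lattice

end ToricCode

end

theorem proposition2 :
    ∃ c C : ℝ, 0 < c ∧ 0 < C ∧
      ∀ (L : ℕ) [NeZero L], 2 ≤ L →
        ∃ U : Matrix (Fin 4 × Fin (2 ^ (2 * L ^ 2 - 2))) (ToricCode.Conf L) ℂ,
          -- `U` is a unitary from the Hilbert space onto logic space ⊗ syndrome space
          U * Uᴴ = 1 ∧ Uᴴ * U = 1 ∧
          -- under which the two tensor factors of the algebra of observables are the logical
          -- and the syndrome algebra
          (∀ M : ToricCode.Op L, M ∈ ToricCode.logicAlgebra L ↔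
            ∃ A : Matrix (Fin 4) (Fin 4) ℂ,
              M = Uᴴ * (A ⊗ₖ (1 : Matrix (Fin (2 ^ (2 * L ^ 2 - 2)))
                (Fin (2 ^ (2 * L ^ 2 - 2))) ℂ)) * U) ∧
          (∀ M : ToricCode.Op L, M ∈ ToricCode.syndromeAlgebra L ↔
            ∃ B : Matrix (Fin (2 ^ (2 * L ^ 2 - 2))) (Fin (2 ^ (2 * L ^ 2 - 2))) ℂ,
              M = Uᴴ * ((1 : Matrix (Fin 4) (Fin 4) ℂ) ⊗ₖ B) * U) ∧
          ∀ β : ℝ, 0 < β →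
            ∃ Lsyn : Matrix (Fin (2 ^ (2 * L ^ 2 - 2))) (Fin (2 ^ (2 * L ^ 2 - 2))) ℂ →ₗ[ℂ]
                Matrix (Fin (2 ^ (2 * L ^ 2 - 2))) (Fin (2 ^ (2 * L ^ 2 - 2))) ℂ,
              -- the local generator acts only on the syndrome factor
              (∀ (A : Matrix (Fin 4) (Fin 4) ℂ)
                (B : Matrix (Fin (2 ^ (2 * L ^ 2 - 2))) (Fin (2 ^ (2 * L ^ 2 - 2))) ℂ),
                ToricCode.localDavies L β (Uᴴ * (A ⊗ₖ B) * U) = Uᴴ * (A ⊗ₖ Lsyn B) * U) ∧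
              -- where it is primitive, with the gap lower bound (number of spins `2 * L ^ 2`)
              LinearMap.ker Lsyn = Submodule.span ℂ {1} ∧
              max (c * Real.exp (-(C * β))) (c / (2 * (L : ℝ) ^ 2) ^ 2) ≤
                ToricCode.spectralGap (-Lsyn) := by
  refine ⟨1 / 6, 4, by norm_num, by norm_num, fun L _ hL => ?_⟩
  refine ⟨ToricCode.factorUnitary (ToricCode.toricEquiv L),
    ToricCode.factorUnitary_mul_conjTranspose _, ToricCode.conjTranspose_mul_factorUnitary _, ?_⟩
  simp only [ToricCode.factorUnitary_conj]
  refine ⟨fun M => ?_, fun M => ?_, fun β hβ => ?_⟩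
  · rw [ToricCode.logicAlgebra_eq_range]
    exact exists_congr fun A => eq_comm
  · rw [ToricCode.syndromeAlgebra_eq_range hL]
    exact exists_congr fun B => eq_comm
  have hL4 : 4 ≤ L * L := Nat.mul_le_mul hL hL
  have hexp : 2 ≤ 2 * L ^ 2 - 2 := by rw [sq]; omega
  obtain ⟨Lsyn, hact, hker, hgap⟩ := (ToricCode.codeFrame_toric hL).exists_syndrome_generator
    (by simpa using by omega)
    (by
      rw [Fintype.card_fin]
      exact Nat.one_lt_two_pow (by omega))
    (ToricCode.toricEquiv L)
    (ToricCode.syndromeAlgebra_eq.symm.trans (ToricCode.syndromeAlgebra_eq_range hL)) hβ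
  refine ⟨Lsyn, fun A B => ?_, hker, le_trans ?_ hgap⟩
  · rw [ToricCode.localDavies_eq, hact]
  have htilt := ToricCode.exp_le_one_sub_tilt hβ
  have hexp1 : Real.exp (-(4 * β)) ≤ 1 := Real.exp_le_one_iff.mpr (by linarith)
  have hexp0 := Real.exp_pos (-(4 * β))
  have hLr : (1 : ℝ) ≤ (L : ℝ) ^ 2 := one_le_pow₀ (by exact_mod_cast (by omega : 1 ≤ L))
  have hcard : ((Fintype.card (Fin L × Fin L) : ℕ) : ℝ) = (L : ℝ) ^ 2 := by
    simp [sq]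
  rw [hcard]
  refine le_min (max_le (by linarith) ?_) (max_le_max (by linarith) ?_)
  · exact div_le_self (by norm_num) (one_le_pow₀ (by linarith))
  · exact div_le_div₀ zero_le_two (by norm_num) (by positivity)
      (pow_le_pow_left₀ (by positivity) (by linarith) 2)
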